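/- Let $\rho$ be a finite non-negative Borel measure on $\mathbb R$ with compact support. In $\mathcal H=L_2(\mathbb R,\rho)$ let $A$ be the operator $(Af)(x)=xf(x)$ and let $B=(\cdot,g)g$, where $g\in L_\infty(\mathbb R)$ satisfies $g=1$ $\rho$-almost everywhere; put $A_\gamma=A+\gamma B$. Let $D_\delta=\{\gamma\in\mathbb C:|\gamma|<\delta\}$. Assume that $\rho$ has the BTB property: its Borel transform $\lambda\mapsto\int_{\mathbb R}\frac{\rho(dt)}{t-\lambda}$ is bounded in the upper half-plane $\{\operatorname{Im}\lambda>0\}$. Then $\rho$ is absolutely continuous with a density $\tilde\rho\in L_\infty(\mathbb R)\cap L_2(\mathbb R)$. Let $P_+$ be the Riesz projection, i.e. the orthogonal projection of $L_2(\mathbb R)$ onto the Hardy space $\{f\in L_2(\mathbb R):\hat f(\omega)=0\text{ for a.e. }\omega<0\}$, where $\hat f(\omega)=\int_{\mathbb R} e^{-2\pi i\omega x}f(x)\,dx$; let $J:L_2(\mathbb R)\to\mathcal H$ be the embedding operator (taking the Lebesgue class of $f$ to its $\rho$-class) and $M_\varphi$ the operator of multiplication by $\varphi$. There exists $\delta>0$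 such that for every $\gamma\in D_\delta$ the function $1+2\pi i\gamma P_+\tilde\rho$ is nonzero almost everywhere and its inverse $\psi_\gamma=(1+2\pi i\gamma P_+\tilde\rho)^{-1}$ belongs to $L_\infty(\mathbb R)$, so that $$U_\gamma^+=I-2\pi i\gamma\, J M_{\psi_\gamma g}P_+M_{\bar g\tilde\rho}$$ is a well-defined bounded operator in $\mathcal H$ (with $J:L_2(\mathbb R)\to\mathcal H$, $M_{\psi_\gamma g}:L_2(\mathbb R)\to L_2(\mathbb R)$, $M_{\bar g\tilde\rho}:\mathcal H\to L_2(\mathbb R)$ bounded), and: (i) $U_\gamma^+$ depends holomorphically on $\gamma\in D_\delta$; (ii) for each real $\gamma\in(-\delta,\delta)$ the operator $U_\gamma^+$ is unitary and $A_\gamma=(U_\gamma^+)^{-1}AU_\gamma^+$. In other words, the pair $A,B$ has the property of holomorphic unitary equivalence (HUE): there exist $\delta>0$ and unitary operators $U_\gamma$, $\gamma\in(-\delta,\delta)$, such that $A_\gamma=(U_\gamma)^{-1}AU_\gamma$ for all $\gamma\in(-\delta,\delta)$, and $\gamma\mapsto U_\gamma$ admits a holomorphic continuation from $(-\delta,\delta)$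 to $D_\delta$. -/

import Mathlib

open MeasureTheory Complex Set FourierTransform
open scoped ENNReal ComplexConjugate

namespace Friedrichs

noncomputable section

/-! ### Holomorphic unitary equivalence -/

/-- The pair of bounded operators `A`, `B` on a Hilbert space `H` has the property of holomorphic
unitary equivalence: for some `δ > 0` there are unitary operators `U γ`, `γ ∈ (-δ, δ)`, with
`A + γ B = (U γ)⁻¹ A (U γ)`, and `γ ↦ U γ` extends holomorphically (in operator norm) to the
open disk of radius `δ`. -/
def HUE {H : Type*} [NormedAddCommGroup H] [InnerProductSpace ℂ H] [CompleteSpace H]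
    (A B : H →L[ℂ] H) : Prop :=
  ∃ δ : ℝ, 0 < δ ∧ ∃ U : ℝ → unitary (H →L[ℂ] H),
    (∀ γ : ℝ, |γ| < δ →
      A + (γ : ℂ) • B = ((U γ)⁻¹ : unitary (H →L[ℂ] H)) * A * (U γ : H →L[ℂ] H)) ∧
    ∃ F : ℂ → (H →L[ℂ] H), DifferentiableOn ℂ F (Metric.ball 0 δ) ∧
      ∀ γ : ℝ, |γ| < δ → F γ = U γ

/-! ### Multiplication operators -/

/-- `T : L²(μ) → L²(ν)` is the operator of multiplication by `φ`: it maps the class of `f` in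
`L²(μ)` to the class of `φ f` in `L²(ν)`, whichever representative `f` is used. -/
def IsMulOp (μ ν : Measure ℝ) (φ : ℝ → ℂ) (T : Lp ℂ 2 μ →L[ℂ] Lp ℂ 2 ν) : Prop :=
  ∀ (f : ℝ → ℂ) (hf : MemLp f 2 μ), T (hf.toLp f) =ᵐ[ν] fun x => φ x * f x

lemma IsMulOp.unique {μ ν : Measure ℝ} {φ : ℝ → ℂ} {S T : Lp ℂ 2 μ →L[ℂ] Lp ℂ 2 ν}
    (hS : IsMulOp μ ν φ S) (hT : IsMulOp μ ν φ T) : S = T := by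
  ext1 f
  have h := (hS f (Lp.memLp f)).trans (hT f (Lp.memLp f)).symm
  rw [Lp.toLp_coeFn] at h
  exact Lp.ext h

open Classical in
/-- The bounded operator `M_φ : L²(μ) → L²(ν)` of multiplication by `φ`, when there is one
(it is then unique); `0` otherwise. -/
def mulOp (μ ν : Measure ℝ) (φ : ℝ → ℂ) : Lp ℂ 2 μ →L[ℂ] Lp ℂ 2 ν :=
  if h : ∃ T, IsMulOp μ ν φ T then h.choose else 0

lemma IsMulOp.mulOp_eq {μ ν : Measure ℝ} {φ : ℝ → ℂ} {T : Lp ℂ 2 μ →L[ℂ] Lp ℂ 2 ν}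
    (hT : IsMulOp μ ν φ T) : mulOp μ ν φ = T := by
  have h : ∃ T, IsMulOp μ ν φ T := ⟨T, hT⟩
  rw [mulOp, dif_pos h]
  exact h.choose_spec.unique hT

/-- Multiplication by an essentially bounded function is a bounded operator in `L²(μ)`. -/
lemma isMulOp_of_memLp_top {μ : Measure ℝ} {φ : ℝ → ℂ} (hφ : MemLp φ ∞ μ) :
    IsMulOp μ μ φ (mulOp μ μ φ) := by
  have key : IsMulOp μ μ φ
      ((ContinuousLinearMap.mul ℂ ℂ).holderL μ ∞ 2 2 (hφ.toLp φ)) := by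
    intro f hf
    have h := ContinuousLinearMap.coeFn_holder (r := 2) (B := ContinuousLinearMap.mul ℂ ℂ)
      (hφ.toLp φ) (hf.toLp f)
    have e : ((ContinuousLinearMap.mul ℂ ℂ).holderL μ ∞ 2 2 (hφ.toLp φ)) (hf.toLp f) =
      (ContinuousLinearMap.mul ℂ ℂ).holder 2 (hφ.toLp φ) (hf.toLp f) := rfl
    rw [e]
    filter_upwards [h, hφ.coeFn_toLp, hf.coeFn_toLp] with x h1 h2 h3
    rw [h1, h2, h3]
    rfl
  rw [key.mulOp_eq]
  exact key

/-! ### The operators `A` and `B` -/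

/-- The operator `(A f)(x) = x f(x)` in `L²(ρ)`. -/
def opA (ρ : Measure ℝ) : Lp ℂ 2 ρ →L[ℂ] Lp ℂ 2 ρ :=
  mulOp ρ ρ (fun x => (x : ℂ))

/-- If `ρ` has compact support, `opA ρ` is indeed multiplication by the independent variable. -/
lemma isMulOp_opA {ρ : Measure ℝ} (hρ : IsCompact ρ.support) :
    IsMulOp ρ ρ (fun x => (x : ℂ)) (opA ρ) := by
  obtain ⟨C, hC⟩ := hρ.isBounded.exists_norm_le
  refine isMulOp_of_memLp_top (memLp_top_of_bound (C := C)
    Complex.measurable_ofReal.aestronglyMeasurable ?_)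
  filter_upwards [Measure.support_mem_ae (μ := ρ)] with x hx
  simpa using hC x hx

lemma memLp_of_ae_eq_one {ρ : Measure ℝ} [IsFiniteMeasure ρ] {g : ℝ → ℂ}
    (hg : ∀ᵐ x ∂ρ, g x = 1) : MemLp g 2 ρ :=
  (memLp_const (1 : ℂ)).ae_eq (hg.mono fun _ h => h.symm)

/-- The rank-one operator `B = (·, g) g` in `L²(ρ)`, where `g = 1` almost everywhere with respect
to `ρ`. (The inner product of Mathlib is conjugate linear in its first argument, and
`rankOne ℂ x y z = ⟪y, z⟫ • x`.) -/
def opB (ρ : Measure ℝ) [IsFiniteMeasure ρ] (g : ℝ → ℂ) (hg : ∀ᵐ x ∂ρ, g x = 1) :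
    Lp ℂ 2 ρ →L[ℂ] Lp ℂ 2 ρ :=
  InnerProductSpace.rankOne ℂ ((memLp_of_ae_eq_one hg).toLp g) ((memLp_of_ae_eq_one hg).toLp g)

/-! ### Boundedness of the Borel transform -/

/-- The Borel transform `λ ↦ ∫ ρ(dt) / (t - λ)`. -/
def borelTransform (ρ : Measure ℝ) (z : ℂ) : ℂ := ∫ t : ℝ, ((t : ℂ) - z)⁻¹ ∂ρ

/-- The Borel transform of `ρ` is bounded in the open upper half-plane. -/
def BTB (ρ : Measure ℝ) : Prop :=
  ∃ C : ℝ, ∀ z : ℂ, 0 < z.im → ‖borelTransform ρ z‖ ≤ C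

/-! ### The Hardy space and the Riesz projection -/

/-- The Hardy space of all `f ∈ L²(ℝ)` whose Fourier transform vanishes almost everywhere on
`(-∞, 0)`. The Fourier transform is `𝓕 f (ω) = ∫ exp(-2πiωx) f(x) dx`. -/
def hardySpace : Submodule ℂ (Lp ℂ 2 (volume : Measure ℝ)) where
  carrier := {f | ∀ᵐ ω ∂(volume : Measure ℝ), ω < 0 → (𝓕 f : Lp ℂ 2 (volume : Measure ℝ)) ω = 0}
  add_mem' := by
    intro f h hf hh
    simp only [mem_ofPred_eq, FourierTransform.fourier_add] at *
    filter_upwards [hf, hh, Lp.coeFn_add (𝓕 f : Lp ℂ 2 (volume : Measure ℝ)) (𝓕 h)]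
      with x h1 h2 h3 hx
    rw [h3, Pi.add_apply, h1 hx, h2 hx, add_zero]
  zero_mem' := by
    have h0 : (𝓕 (0 : Lp ℂ 2 (volume : Measure ℝ)) : Lp ℂ 2 (volume : Measure ℝ)) = 0 :=
      (Lp.fourierTransformₗᵢ ℝ ℂ).map_zero
    simp only [mem_ofPred_eq, h0]
    filter_upwards [Lp.coeFn_zero ℂ 2 (volume : Measure ℝ)] with x h1 _
    rw [h1, Pi.zero_apply]
  smul_mem' := by
    intro c f hf
    simp only [mem_ofPred_eq, FourierTransform.fourier_smul] at *
    filter_upwards [hf, Lp.coeFn_smul c (𝓕 f : Lp ℂ 2 (volume : Measure ℝ))] with x h1 h3 hx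
    rw [h3, Pi.smul_apply, h1 hx, smul_zero]

lemma isClosed_hardySpace :
    IsClosed (hardySpace : Set (Lp ℂ 2 (volume : Measure ℝ))) := by
  have h : (hardySpace : Set (Lp ℂ 2 (volume : Measure ℝ))) =
      (fun f : Lp ℂ 2 (volume : Measure ℝ) => LpToLpRestrictCLM ℝ ℂ ℂ volume 2 (Iio 0)
        (Lp.fourierTransformₗᵢ ℝ ℂ f)) ⁻¹' {0} := by
    ext f
    have e : (LpToLpRestrictCLM ℝ ℂ ℂ volume 2 (Iio 0) (Lp.fourierTransformₗᵢ ℝ ℂ f)) =ᵐ[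
        volume.restrict (Iio 0)] (𝓕 f : Lp ℂ 2 (volume : Measure ℝ)) :=
      LpToLpRestrictCLM_coeFn ℂ (Iio 0) _
    rw [mem_preimage, mem_singleton_iff, Lp.eq_zero_iff_ae_eq_zero]
    change (∀ᵐ ω ∂(volume : Measure ℝ), ω ∈ Iio 0 →
      (𝓕 f : Lp ℂ 2 (volume : Measure ℝ)) ω = 0) ↔ _
    rw [← ae_restrict_iff' measurableSet_Iio]
    exact ⟨fun h => e.trans h, fun h => e.symm.trans h⟩
  rw [h]
  refine isClosed_singleton.preimage ?_
  exact (ContinuousLinearMap.continuous _).comp (Lp.fourierTransformₗᵢ ℝ ℂ).continuous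

instance : hardySpace.HasOrthogonalProjection :=
  haveI : CompleteSpace hardySpace := isClosed_hardySpace.completeSpace_coe
  inferInstance

/-- The Riesz projection `P₊`: the orthogonal projection of `L²(ℝ)` onto the Hardy space. -/
def rieszProj : Lp ℂ 2 (volume : Measure ℝ) →L[ℂ] Lp ℂ 2 (volume : Measure ℝ) :=
  hardySpace.starProjection

/-! ### The operators of Friedrichs -/

/-- The density of (the absolutely continuous part of) `ρ` with respect to Lebesgue measure. -/
def density (ρ : Measure ℝ) (x : ℝ) : ℂ := ((ρ.rnDeriv volume x).toReal : ℂ)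

open Classical in
/-- The density as an element of `L²(ℝ)`, when it is square integrable; `0` otherwise. -/
def densityL2 (ρ : Measure ℝ) : Lp ℂ 2 (volume : Measure ℝ) :=
  if h : MemLp (density ρ) 2 volume then h.toLp (density ρ) else 0

/-- The function `1 + 2πiγ P₊ρ̃`, where `ρ̃` is the density of `ρ`. -/
def psiDenom (ρ : Measure ℝ) (γ : ℂ) (x : ℝ) : ℂ :=
  1 + 2 * Real.pi * I * γ * rieszProj (densityL2 ρ) x

/-- The function `ψ_γ = (1 + 2πiγ P₊ρ̃)⁻¹`. -/
def psi (ρ : Measure ℝ) (γ : ℂ) (x : ℝ) : ℂ := (psiDenom ρ γ x)⁻¹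

/-- The embedding operator `J : L²(ℝ) → L²(ρ)`, which takes the class of `f` to the class
of `f`. -/
def opJ (ρ : Measure ℝ) : Lp ℂ 2 (volume : Measure ℝ) →L[ℂ] Lp ℂ 2 ρ :=
  mulOp volume ρ (fun _ => 1)

/-- The operator `U_γ⁺ = I - 2πiγ J M_{ψ_γ g} P₊ M_{ḡ ρ̃}` in `L²(ρ)`. -/
def Uplus (ρ : Measure ℝ) (g : ℝ → ℂ) (γ : ℂ) : Lp ℂ 2 ρ →L[ℂ] Lp ℂ 2 ρ :=
  ContinuousLinearMap.id ℂ _ - (2 * Real.pi * I * γ) •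
    (opJ ρ ∘L mulOp volume volume (fun x => psi ρ γ x * g x) ∘L rieszProj ∘L
      mulOp ρ volume (fun x => conj (g x) * density ρ x))

/-- All the objects in the formula for `U_γ⁺` make sense: `ρ` is absolutely continuous, its
density is bounded and square integrable, the function `1 + 2πiγ P₊ρ̃` is almost nowhere zero and
has a bounded inverse, and the three operators `J`, `M_{ψ_γ g}`, `M_{ḡ ρ̃}` are bounded
operators. -/
structure UplusWellDefined (ρ : Measure ℝ) (g : ℝ → ℂ) (γ : ℂ) : Prop where
  absolutelyContinuous : ρ ≪ volume
  density_bounded : MemLp (density ρ) ∞ volume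
  density_memL2 : MemLp (density ρ) 2 volume
  psiDenom_ne_zero : ∀ᵐ x : ℝ, psiDenom ρ γ x ≠ 0
  psi_bounded : MemLp (psi ρ γ) ∞ volume
  isMulOp_opJ : IsMulOp volume ρ (fun _ => 1) (opJ ρ)
  isMulOp_psi : IsMulOp volume volume (fun x => psi ρ γ x * g x)
    (mulOp volume volume (fun x => psi ρ γ x * g x))
  isMulOp_density : IsMulOp ρ volume (fun x => conj (g x) * density ρ x)
    (mulOp ρ volume (fun x => conj (g x) * density ρ x))

end

end Friedrichs

namespace Friedrichs

open Filter Topology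

-- The imaginary part of the Borel transform is a Poisson integral, so its boundedness by `C` forces
-- `ρ ≤ C · Lebesgue` (`measure_le_volume`); hence `ρ̃` is bounded, and being integrable it lies in
-- L². Moreover `P₊ρ̃` is an almost everywhere limit of the Cauchy integrals `(2πi)⁻¹ ∫ ρ̃(t) dt /
-- (t - x - iε)` (`exists_seq_tendsto_cauchy`), so it is bounded by `C/2π`, and multiplication by
-- it, called `G`, maps the Hardy space into itself (`IsMulOp.mem_hardySpace`).
--
-- Write `b = 2πiγ` and `P = P₊`. For small `γ` multiplication by `ψ_γ` is `Ψ = (1 + bG)⁻¹`, which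
-- is holomorphic in `γ`. Since `M_ρ̃ = J*` and `g = 1` wherever `ρ` lives, `U = 1 - b J Ψ P J*`
-- (`Uplus_eq`), which gives the holomorphy of `U`.
--
-- For real `γ`, `b` is imaginary. Two facts give `U*U = 1` by pure algebra
-- (`isometry_of_add_star`): `G + G* = J*J`, because `P₊ρ̃` and its conjugate sum to `ρ̃`
-- (`rieszProj_add_conj`), and `PΨP = ΨP`, by the Neumann series. As `U_0 = 1`, `U_γ` is invertible
-- near `0`, so the isometry is unitary.
--
-- The intertwining `U A_γ = A U` (`Uplus_mul_eq`) rests on the commutator of `P₊` with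
-- multiplication by `x`, which sends `h` to the constant `(2πi)⁻¹ ∫ h` up to sign
-- (`ofReal_mul_rieszProj`); this is how the rank-one term `γB` is absorbed.

local notation "L2" => Lp ℂ 2 (volume : Measure ℝ)

/-! ### From a bounded Borel transform to domination by Lebesgue measure. -/

lemma sub_ofReal_ne_zero_of_im_pos {z : ℂ} (hz : 0 < z.im) (t : ℝ) : (t : ℂ) - z ≠ 0 := by
  intro h
  have := congrArg Complex.im h
  simp at this
  linarith

lemma norm_inv_ofReal_sub_le {z : ℂ} (hz : 0 < z.im) (t : ℝ) : ‖((t : ℂ) - z)⁻¹‖ ≤ z.im⁻¹ := by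
  rw [norm_inv]
  refine inv_anti₀ hz ?_
  have := Complex.abs_im_le_norm ((t : ℂ) - z)
  simp only [Complex.sub_im, Complex.ofReal_im, zero_sub, abs_neg] at this
  exact (le_abs_self _).trans this

lemma continuous_inv_ofReal_sub {z : ℂ} (hz : 0 < z.im) :
    Continuous fun t : ℝ => ((t : ℂ) - z)⁻¹ :=
  (Complex.continuous_ofReal.sub continuous_const).inv₀ (sub_ofReal_ne_zero_of_im_pos hz)

lemma integrable_inv_ofReal_sub (ρ : Measure ℝ) [IsFiniteMeasure ρ] {z : ℂ} (hz : 0 < z.im) :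
    Integrable (fun t : ℝ => ((t : ℂ) - z)⁻¹) ρ :=
  Integrable.of_bound (continuous_inv_ofReal_sub hz).aestronglyMeasurable _
    (ae_of_all _ (norm_inv_ofReal_sub_le hz))

/-- The imaginary part of the Borel transform is the Poisson integral, which controls the mass of
an interval. -/
lemma measure_real_Icc_le (ρ : Measure ℝ) [IsFiniteMeasure ρ] {C : ℝ}
    (hC : ∀ z : ℂ, 0 < z.im → ‖borelTransform ρ z‖ ≤ C) (x : ℝ) {ε : ℝ} (hε : 0 < ε) :
    ρ.real (Icc (x - ε) (x + ε)) ≤ C * (2 * ε) := by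
  set z : ℂ := x + ε * I with hz
  have hzi : z.im = ε := by simp [hz]
  have hzp : 0 < z.im := by rw [hzi]; exact hε
  have him : ∀ t : ℝ, (((t : ℂ) - z)⁻¹).im = ε / ((t - x) ^ 2 + ε ^ 2) := by
    intro t
    rw [Complex.inv_im, Complex.normSq_apply]
    simp [hz]
    ring_nf
  have h1 : (borelTransform ρ z).im = ∫ t, ε / ((t - x) ^ 2 + ε ^ 2) ∂ρ := by
    have h := integral_im (𝕜 := ℂ) (integrable_inv_ofReal_sub ρ hzp)
    simp only [RCLike.im_to_complex, him] at h
    rw [borelTransform, h]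
  have hint : Integrable (fun t : ℝ => ε / ((t - x) ^ 2 + ε ^ 2)) ρ := by
    have h := (integrable_inv_ofReal_sub ρ hzp).im
    simpa only [RCLike.im_to_complex, him] using h
  have h2 : (borelTransform ρ z).im ≤ C :=
    (le_abs_self _).trans ((Complex.abs_im_le_norm _).trans (hC z hzp))
  have h3 : ρ.real (Icc (x - ε) (x + ε)) * (2 * ε)⁻¹ ≤ ∫ t, ε / ((t - x) ^ 2 + ε ^ 2) ∂ρ := by
    have e : ∫ t in Icc (x - ε) (x + ε), (2 * ε)⁻¹ ∂ρ =
        ρ.real (Icc (x - ε) (x + ε)) * (2 * ε)⁻¹ := by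
      simp
    rw [← e]
    calc ∫ t in Icc (x - ε) (x + ε), (2 * ε)⁻¹ ∂ρ
        ≤ ∫ t in Icc (x - ε) (x + ε), ε / ((t - x) ^ 2 + ε ^ 2) ∂ρ := by
          refine setIntegral_mono_on (integrable_const _) hint.integrableOn measurableSet_Icc ?_
          intro t ht
          -- On the interval the denominator is at most `2ε²`, so the Poisson kernel is at least
          -- `1/(2ε)`.
          have ht2 : (t - x) ^ 2 ≤ ε ^ 2 := by
            rw [sq_le_sq, abs_of_pos hε, abs_le]
            constructor <;> linarith [ht.1, ht.2]
          rw [inv_eq_one_div, div_le_div_iff₀ (by positivity) (by positivity)]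
          nlinarith
      _ ≤ _ := setIntegral_le_integral hint (ae_of_all _ fun t => by positivity)
  rw [← h1] at h3
  have h4 := h3.trans h2
  rwa [← div_eq_mul_inv, div_le_iff₀ (by positivity)] at h4

/-- A finite measure whose Borel transform is bounded by `C` is at most `C` times the Lebesgue
measure. -/
lemma measure_le_volume (ρ : Measure ℝ) [IsFiniteMeasure ρ] {C : ℝ}
    (hC : ∀ z : ℂ, 0 < z.im → ‖borelTransform ρ z‖ ≤ C) :
    ρ ≤ ENNReal.ofReal C • volume := by
  have hC0 : 0 ≤ C := (norm_nonneg _).trans (hC I (by simp))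
  have key : ∀ a b : ℝ, ρ (Ioc a b) ≤ ENNReal.ofReal (C * (b - a)) := by
    intro a b
    rcases le_or_gt b a with h | h
    · simp [Ioc_eq_empty (not_lt.2 h)]
    · have := measure_real_Icc_le ρ hC ((a + b) / 2) (ε := (b - a) / 2) (by linarith)
      have e1 : (a + b) / 2 - (b - a) / 2 = a := by ring
      have e2 : (a + b) / 2 + (b - a) / 2 = b := by ring
      rw [e1, e2, mul_div_cancel₀ _ (two_ne_zero' ℝ)] at this
      refine (measure_mono Ioc_subset_Icc_self).trans ?_
      rw [← ofReal_measureReal]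
      exact ENNReal.ofReal_le_ofReal this
  -- `C · Lebesgue` is written as a Stieltjes measure, whose outer measure is generated by half-open
  -- intervals; the bound `key` on intervals then extends to all Borel sets.
  set f : StieltjesFunction ℝ := (C.toNNReal) • StieltjesFunction.id with hf
  have hfC : ∀ a b : ℝ, f b - f a = C * (b - a) := by
    intro a b
    change C.toNNReal * b - C.toNNReal * a = _
    rw [Real.coe_toNNReal _ hC0]; ring
  have hvol : f.measure = ENNReal.ofReal C • volume := by
    rw [hf, StieltjesFunction.measure_smul, Real.volume_eq_stieltjes_id]
    rfl
  rw [← hvol, Measure.le_iff]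
  intro s hs
  have h1 : ρ.toOuterMeasure ≤ f.outer := by
    rw [StieltjesFunction.outer, OuterMeasure.le_ofFunction]
    intro s
    rw [StieltjesFunction.length_eq]
    refine le_iInf fun a => le_iInf fun b => le_iInf fun h => ?_
    have hbot : (botSet : Set ℝ) = ∅ :=
      eq_empty_of_forall_notMem fun x hx => not_isBot x hx
    rw [hbot, sdiff_empty] at h
    rw [hfC]
    exact (measure_mono h).trans (key a b)
  have h2 : f.measure s = f.outer s := by
    rw [StieltjesFunction.measure]
    rfl
  rw [h2]
  exact h1 s

/-! ### Boundedness and integrability of the density. -/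

section DensityBounds

variable (ρ : Measure ℝ)

lemma rnDeriv_le_of_le_smul {C : ℝ≥0∞} (h : ρ ≤ C • volume) :
    ∀ᵐ x : ℝ, ρ.rnDeriv volume x ≤ C := by
  refine ae_le_of_forall_setLIntegral_le_of_sigmaFinite (Measure.measurable_rnDeriv _ _) ?_
  intro s hs _
  refine (Measure.setLIntegral_rnDeriv_le s).trans ?_
  simpa using h s

lemma norm_density_le {C : ℝ} (hC : 0 ≤ C) (h : ρ ≤ ENNReal.ofReal C • volume) :
    ∀ᵐ x : ℝ, ‖density ρ x‖ ≤ C := by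
  filter_upwards [rnDeriv_le_of_le_smul ρ h] with x hx
  rw [density, Complex.norm_real, Real.norm_of_nonneg ENNReal.toReal_nonneg]
  exact ENNReal.toReal_le_of_le_ofReal hC hx

lemma measurable_density : Measurable (density ρ) :=
  Complex.measurable_ofReal.comp (Measure.measurable_rnDeriv _ _).ennreal_toReal

lemma integrable_density [IsFiniteMeasure ρ] : Integrable (density ρ) volume :=
  Measure.integrable_toReal_rnDeriv.ofReal

lemma memLp_top_density {C : ℝ} (hC : 0 ≤ C) (h : ρ ≤ ENNReal.ofReal C • volume) :
    MemLp (density ρ) ∞ volume :=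
  memLp_top_of_bound (measurable_density ρ).aestronglyMeasurable C (norm_density_le ρ hC h)

lemma memLp_two_density [IsFiniteMeasure ρ] {C : ℝ}
    (hC : 0 ≤ C) (h : ρ ≤ ENNReal.ofReal C • volume) :
    MemLp (density ρ) 2 volume := by
  rw [memLp_two_iff_integrable_sq_norm (measurable_density ρ).aestronglyMeasurable]
  refine ((integrable_density ρ).norm.const_mul C).mono'
    ((measurable_density ρ).norm.pow_const 2).aestronglyMeasurable ?_
  filter_upwards [norm_density_le ρ hC h] with x hx
  rw [norm_pow, norm_norm, sq]
  exact mul_le_mul_of_nonneg_right hx (norm_nonneg _)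

lemma integral_density_mul [IsFiniteMeasure ρ] (h : ρ ≪ volume) (f : ℝ → ℂ) :
    ∫ x, density ρ x * f x = ∫ x, f x ∂ρ := by
  rw [← integral_rnDeriv_smul h]
  simp [density, Complex.real_smul]

lemma integrable_density_mul_iff [IsFiniteMeasure ρ] (h : ρ ≪ volume) {f : ℝ → ℂ} :
    Integrable (fun x => density ρ x * f x) volume ↔ Integrable f ρ := by
  rw [← integrable_rnDeriv_smul_iff h]
  simp [density, Complex.real_smul]

end DensityBounds

/-! ### The Fourier transform on `L¹ ∩ L²` -/

lemma continuous_fourier_of_integrable {f : ℝ → ℂ} (hf : Integrable f) : Continuous (𝓕 f) :=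
  VectorFourier.fourierIntegral_continuous Real.continuous_fourierChar continuous_inner hf

lemma norm_fourier_le (f : ℝ → ℂ) (ω : ℝ) : ‖𝓕 f ω‖ ≤ ∫ x, ‖f x‖ :=
  VectorFourier.norm_fourierIntegral_le_integral_norm _ _ _ _ _

lemma integral_fourier_mul_eq {f g : ℝ → ℂ} (hf : Integrable f) (hg : Integrable g) :
    ∫ ξ, 𝓕 f ξ * g ξ = ∫ x, f x * 𝓕 g x := by
  have h := VectorFourier.integral_fourierIntegral_smul_eq_flip (L := innerₗ ℝ)
    (μ := volume) (ν := volume) Real.continuous_fourierChar continuous_inner hf hg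
  rw [flip_innerₗ] at h
  exact h

lemma integral_fourierInv_mul_eq {f g : ℝ → ℂ} (hf : Integrable f) (hg : Integrable g) :
    ∫ ξ, 𝓕⁻ f ξ * g ξ = ∫ x, f x * 𝓕⁻ g x := by
  have h := VectorFourier.integral_fourierIntegral_smul_eq_flip (L := -innerₗ ℝ)
    (μ := volume) (ν := volume) Real.continuous_fourierChar continuous_inner.neg hf hg
  have e : (-innerₗ ℝ).flip = -innerₗ ℝ := by
    ext
    simp
  rw [e] at h
  exact h

lemma continuous_fourierInv_of_integrable {f : ℝ → ℂ} (hf : Integrable f) : Continuous (𝓕⁻ f) := by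
  have h := (continuous_fourier_of_integrable hf).comp continuous_neg
  have e : 𝓕⁻ f = 𝓕 f ∘ Neg.neg := funext fun x => Real.fourierInv_eq_fourier_neg f x
  rwa [e]

/-- Serves to compare the L² Fourier transform, known as a tempered distribution, with the Fourier
integral, known pointwise. -/
lemma ae_eq_of_integral_schwartz_mul_eq {F G : ℝ → ℂ} (hF : LocallyIntegrable F)
    (hG : LocallyIntegrable G)
    (h : ∀ φ : SchwartzMap ℝ ℂ, ∫ x, φ x * F x = ∫ x, φ x * G x) : F =ᵐ[volume] G := by
  refine ae_eq_of_integral_contDiff_smul_eq hF hG ?_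
  intro g hg hgs
  have hg₁ : HasCompactSupport (Complex.ofRealCLM ∘ g) := hgs.comp_left rfl
  simp only [Complex.real_smul]
  exact h (hg₁.toSchwartzMap (Complex.ofRealCLM.contDiff.comp hg))

/-- On `L¹ ∩ L²` the Fourier transform of `L²` is given by the Fourier integral. -/
lemma fourier_toLp_ae_eq {f : ℝ → ℂ} (hf1 : Integrable f) (hf2 : MemLp f 2) :
    (𝓕 (hf2.toLp f) : L2) =ᵐ[volume] 𝓕 f := by
  refine ae_eq_of_integral_schwartz_mul_eq
    ((Lp.memLp (𝓕 (hf2.toLp f))).locallyIntegrable (by norm_num))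
    (continuous_fourier_of_integrable hf1).locallyIntegrable fun φ => ?_
  have h1 := congrArg (fun T => T φ) (Lp.fourier_toTemperedDistribution_eq (hf2.toLp f))
  simp only [TemperedDistribution.fourier_apply, Lp.toTemperedDistribution_apply,
    smul_eq_mul] at h1
  rw [← h1, ← integral_fourier_mul_eq φ.integrable hf1, ← SchwartzMap.fourier_coe]
  exact integral_congr_ae (hf2.coeFn_toLp.mono fun x hx => by simp only [hx])

/-- On `L¹ ∩ L²` the inverse Fourier transform of `L²` is given by the inverse Fourier integral. -/
lemma fourierInv_toLp_ae_eq {f : ℝ → ℂ} (hf1 : Integrable f) (hf2 : MemLp f 2) :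
    (𝓕⁻ (hf2.toLp f) : L2) =ᵐ[volume] 𝓕⁻ f := by
  refine ae_eq_of_integral_schwartz_mul_eq
    ((Lp.memLp (𝓕⁻ (hf2.toLp f))).locallyIntegrable (by norm_num))
    (continuous_fourierInv_of_integrable hf1).locallyIntegrable fun φ => ?_
  have h1 := congrArg (fun T => T φ) (Lp.fourierInv_toTemperedDistribution_eq (hf2.toLp f))
  simp only [TemperedDistribution.fourierInv_apply, Lp.toTemperedDistribution_apply,
    smul_eq_mul] at h1
  rw [← h1, ← integral_fourierInv_mul_eq φ.integrable hf1, ← SchwartzMap.fourierInv_coe]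
  exact integral_congr_ae (hf2.coeFn_toLp.mono fun x hx => by simp only [hx])

/-! ### Dominated convergence in `L²` and Fourier multipliers -/

lemma tendsto_toLp_of_dominated {μ : Measure ℝ} {f : ℕ → ℝ → ℂ} {g : ℝ → ℂ} {b : ℝ → ℂ}
    (hf : ∀ n, MemLp (f n) 2 μ) (hg : MemLp g 2 μ) (hb : MemLp b 2 μ)
    (hfb : ∀ n, ∀ᵐ x ∂μ, ‖f n x - g x‖ ≤ ‖b x‖)
    (h : ∀ᵐ x ∂μ, Tendsto (fun n => f n x) atTop (𝓝 (g x))) :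
    Tendsto (fun n => (hf n).toLp (f n)) atTop (𝓝 (hg.toLp g)) := by
  rw [Lp.tendsto_Lp_iff_tendsto_eLpNorm'']
  have e : ∀ n, eLpNorm (f n - g) 2 μ = (∫⁻ x, ‖f n x - g x‖ₑ ^ (2 : ℝ) ∂μ) ^ (1 / 2 : ℝ) := by
    intro n
    rw [eLpNorm_eq_lintegral_rpow_enorm_toReal (by norm_num) (by norm_num)]
    simp
  simp only [e]
  have hz : (0 : ℝ≥0∞) = (∫⁻ _, 0 ∂μ) ^ (1 / 2 : ℝ) := by simp
  rw [hz]
  refine ((ENNReal.continuous_rpow_const).tendsto _).comp ?_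
  refine tendsto_lintegral_of_dominated_convergence' (fun x => ‖b x‖ₑ ^ (2 : ℝ)) ?_ ?_ ?_ ?_
  · exact fun n => ((hf n).1.sub hg.1).enorm.pow_const _
  · intro n
    filter_upwards [hfb n] with x hx
    gcongr
    exact enorm_le_iff_norm_le.2 hx
  · have := lintegral_rpow_enorm_lt_top_of_eLpNorm_lt_top (by norm_num) (by norm_num) hb.2
    simpa using this.ne
  · filter_upwards [h] with x hx
    have h1 : Tendsto (fun n => ‖f n x - g x‖ₑ) atTop (𝓝 0) := by
      have := (tendsto_sub_nhds_zero_iff.2 hx).enorm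
      simpa using this
    have h2 := ((ENNReal.continuous_rpow_const (y := 2)).tendsto 0).comp h1
    simpa [Function.comp_def] using h2

/-- If integrable multipliers `ψ n`, bounded by `1`, converge pointwise to `ψ`, then along a
subsequence the corresponding Fourier integrals converge almost everywhere. -/
lemma exists_seq_tendsto_fourierInv_mul {h : ℝ → ℂ} (h1 : Integrable h) (h2 : MemLp h 2)
    {ψ : ℕ → ℝ → ℂ} {ψlim : ℝ → ℂ} (hψ : ∀ n, Integrable (ψ n)) (hψ1 : ∀ n ω, ‖ψ n ω‖ ≤ 1)
    (hlim : ∀ᵐ ω, Tendsto (fun n => ψ n ω) atTop (𝓝 (ψlim ω))) {Q : L2}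
    (hQ : (𝓕 Q : L2) =ᵐ[volume] fun ω => ψlim ω * (𝓕 (h2.toLp h) : L2) ω) :
    ∃ ns : ℕ → ℕ, StrictMono ns ∧ ∀ᵐ x,
      Tendsto (fun k => 𝓕⁻ (fun ω => ψ (ns k) ω * 𝓕 h ω) x) atTop (𝓝 (Q x)) := by
  have hF := fourier_toLp_ae_eq h1 h2
  have hF2 : MemLp (𝓕 h) 2 := (memLp_congr_ae hF).1 (Lp.memLp _)
  have hm : ∀ n, AEStronglyMeasurable (fun ω => ψ n ω * 𝓕 h ω) volume := fun n =>
    (hψ n).1.mul hF2.1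
  have hb1 : ∀ n, Integrable fun ω => ψ n ω * 𝓕 h ω := fun n =>
    (hψ n).mul_bdd (c := ∫ x, ‖h x‖) hF2.1 (ae_of_all _ (norm_fourier_le h))
  have hle : ∀ n ω, ‖ψ n ω * 𝓕 h ω‖ ≤ ‖𝓕 h ω‖ := fun n ω => by
    rw [norm_mul]
    exact mul_le_of_le_one_left (norm_nonneg _) (hψ1 n ω)
  have hb2 : ∀ n, MemLp (fun ω => ψ n ω * 𝓕 h ω) 2 := fun n =>
    hF2.mono (hm n) (ae_of_all _ (hle n))
  have hQ' : (𝓕 Q : L2) =ᵐ[volume] fun ω => ψlim ω * 𝓕 h ω := by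
    filter_upwards [hQ, hF] with ω e1 e2
    rw [e1, e2]
  have hlim' : ∀ᵐ ω, Tendsto (fun n => ψ n ω * 𝓕 h ω) atTop (𝓝 ((𝓕 Q : L2) ω)) := by
    filter_upwards [hlim, hQ'] with ω e1 e2
    rw [e2]
    exact e1.mul_const _
  have hT : Tendsto (fun n => (hb2 n).toLp) atTop
      (𝓝 ((Lp.memLp (𝓕 Q : L2)).toLp (𝓕 Q : L2))) := by
    -- The limit inherits the bound `‖𝓕 h‖` from the approximants, so twice `𝓕 h` dominates the
    -- differences.
    refine tendsto_toLp_of_dominated hb2 (Lp.memLp _) (hF2.const_mul 2) (fun n => ?_) hlim'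
    filter_upwards [hlim'] with ω e
    have e1 : ‖(𝓕 Q : L2) ω‖ ≤ ‖𝓕 h ω‖ :=
      le_of_tendsto e.norm (Eventually.of_forall fun n => hle n ω)
    calc _ ≤ ‖ψ n ω * 𝓕 h ω‖ + ‖(𝓕 Q : L2) ω‖ := norm_sub_le _ _
      _ ≤ ‖𝓕 h ω‖ + ‖𝓕 h ω‖ := add_le_add (hle n ω) e1
      _ = ‖2 * 𝓕 h ω‖ := by rw [norm_mul]; simp; ring
  rw [Lp.toLp_coeFn] at hT
  -- Plancherel carries the L² convergence back to the `x` side, where a subsequence converges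
  -- almost everywhere.
  have hT2 : Tendsto (fun n => (𝓕⁻ ((hb2 n).toLp) : L2)) atTop (𝓝 (𝓕⁻ (𝓕 Q : L2))) :=
    ((Lp.fourierTransformₗᵢ ℝ ℂ).symm.continuous.tendsto _).comp hT
  rw [FourierTransform.fourierInv_fourier_eq] at hT2
  obtain ⟨ns, hns, hae⟩ := (tendstoInMeasure_of_tendsto_Lp hT2).exists_seq_tendsto_ae
  refine ⟨ns, hns, ?_⟩
  filter_upwards [hae, ae_all_iff.2 fun n => fourierInv_toLp_ae_eq (hb1 n) (hb2 n)] with x e1 e2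
  simpa only [e2] using e1

/-- The Riesz projection is the Fourier multiplier with symbol the indicator function of the
positive half-line. -/
lemma fourier_rieszProj (f : L2) :
    (𝓕 (rieszProj f) : L2) =ᵐ[volume] (Ioi (0 : ℝ)).indicator (𝓕 f : L2) := by
  have hw : MemLp ((Ioi (0 : ℝ)).indicator (𝓕 f : L2)) 2 :=
    (Lp.memLp (𝓕 f : L2)).indicator measurableSet_Ioi
  have hu : (𝓕 (𝓕⁻ (hw.toLp _) : L2) : L2) = hw.toLp _ :=
    FourierTransform.fourier_fourierInv_eq _
  have key : rieszProj f = 𝓕⁻ (hw.toLp _) := by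
    refine Submodule.eq_starProjection_of_mem_of_inner_eq_zero ?_ ?_
    · change ∀ᵐ ω ∂(volume : Measure ℝ), ω < 0 → _
      rw [hu]
      filter_upwards [hw.coeFn_toLp] with ω e hω
      rw [e, indicator_of_notMem]
      exact not_lt.2 hω.le
    · intro k hk
      rw [← Lp.inner_fourier_eq, L2.inner_def]
      have hk' : ∀ᵐ ω ∂(volume : Measure ℝ), ω < 0 → (𝓕 k : L2) ω = 0 := hk
      -- `hardySpace` constrains only `ω < 0`, while the indicator vanishes at `0` too; that point
      -- is null.
      have h0 : ∀ᵐ ω : ℝ, ω ≠ 0 := by simp [ae_iff]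
      have hs : (𝓕 (f - 𝓕⁻ (hw.toLp _)) : L2) = 𝓕 f - hw.toLp _ := by
        conv_rhs => rw [← hu]
        exact (Lp.fourierTransformₗᵢ ℝ ℂ).map_sub _ _
      rw [hs]
      rw [← integral_zero ℝ ℂ]
      refine integral_congr_ae ?_
      filter_upwards [hw.coeFn_toLp, hk', h0, Lp.coeFn_sub (𝓕 f : L2) (hw.toLp _)]
        with ω e1 e2 e3 e4
      rcases lt_or_gt_of_ne e3 with hω | hω
      · rw [e2 hω, inner_zero_right]
      · rw [e4, Pi.sub_apply, e1, indicator_of_mem (mem_Ioi.2 hω), sub_self, inner_zero_left]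
  rw [key, hu]
  exact hw.coeFn_toLp

/-! ### Boundary values of Cauchy integrals -/

noncomputable section

/-- The one-sided exponential cutoff. -/
def cutoff (ε : ℝ) : ℝ → ℂ := (Ioi (0 : ℝ)).indicator fun ω => cexp (-(2 * Real.pi * ε) * ω)

/-- The Cauchy integral of `h` at `x + i ε`. -/
def cauchy (h : ℝ → ℂ) (ε x : ℝ) : ℂ :=
  (2 * Real.pi * I)⁻¹ * ∫ t, h t * ((t : ℂ) - (x + ε * I))⁻¹

lemma norm_cutoff_le {ε : ℝ} (hε : 0 < ε) (ω : ℝ) : ‖cutoff ε ω‖ ≤ 1 := by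
  rw [cutoff]
  refine (norm_indicator_eq_indicator_norm _ _).le.trans ?_
  refine indicator_le' (fun ω hω => ?_) (fun _ _ => zero_le_one) ω
  rw [Complex.norm_exp, Real.exp_le_one_iff]
  have hω' : (0 : ℝ) < ω := hω
  have : 0 ≤ 2 * Real.pi * ε * ω := by positivity
  simpa using this

lemma integrable_cutoff {ε : ℝ} (hε : 0 < ε) : Integrable (cutoff ε) := by
  rw [cutoff, integrable_indicator_iff measurableSet_Ioi]
  refine integrableOn_exp_mul_complex_Ioi ?_ 0
  have : 0 < 2 * Real.pi * ε := by positivity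
  simpa using this

lemma tendsto_cutoff {u : ℕ → ℝ} (hu : Tendsto u atTop (𝓝 0)) (ω : ℝ) :
    Tendsto (fun n => cutoff (u n) ω) atTop (𝓝 ((Ioi (0 : ℝ)).indicator 1 ω)) := by
  by_cases hω : ω ∈ Ioi (0 : ℝ)
  · simp only [cutoff, indicator_of_mem hω, Pi.one_apply]
    have hc : Continuous fun ε : ℝ => cexp (-(2 * Real.pi * ε) * ω) := by fun_prop
    have := (hc.tendsto 0).comp hu
    simpa [Function.comp_def] using this
  · simp only [cutoff, indicator_of_notMem hω]
    exact tendsto_const_nhds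

/-- Moving the Fourier transform from `h` onto the other factor leaves `∫₀^∞ exp(2πi(z - t)ω) dω`
with `z = x + iε`, which is the Cauchy kernel. -/
lemma fourierInv_cutoff_mul {h : ℝ → ℂ} (hh : Integrable h) {ε : ℝ} (hε : 0 < ε) (x : ℝ) :
    𝓕⁻ (fun ω => cutoff ε ω * 𝓕 h ω) x = cauchy h ε x := by
  set G : ℝ → ℂ := fun ω => cexp (2 * Real.pi * x * ω * I) * cutoff ε ω with hG
  have hGi : Integrable G := by
    refine (integrable_cutoff hε).bdd_mul (c := 1)
      (Continuous.aestronglyMeasurable (by fun_prop)) (ae_of_all _ fun ω => ?_)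
    rw [Complex.norm_exp]
    simp
  have e1 : 𝓕⁻ (fun ω => cutoff ε ω * 𝓕 h ω) x = ∫ ω, G ω * 𝓕 h ω := by
    rw [Real.fourierInv_eq']
    refine integral_congr_ae (ae_of_all _ fun ω => ?_)
    simp only [hG, smul_eq_mul, ← mul_assoc]
    congr 3
    simp
    ring
  rw [e1, ← integral_fourier_mul_eq hGi hh, cauchy, ← integral_const_mul]
  refine integral_congr_ae (ae_of_all _ fun t => ?_)
  set z : ℂ := x + ε * I with hz
  have hzi : 0 < z.im := by simpa [hz] using hε
  have e2 : 𝓕 G t = ∫ ω in Ioi (0 : ℝ), cexp ((2 * Real.pi * I * (z - t)) * ω) := by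
    rw [Real.fourier_real_eq_integral_exp_smul, ← integral_indicator measurableSet_Ioi]
    refine integral_congr_ae (ae_of_all _ fun ω => ?_)
    by_cases hω : ω ∈ Ioi (0 : ℝ)
    · simp only [hG, cutoff, indicator_of_mem hω, smul_eq_mul, ← Complex.exp_add]
      congr 1
      simp only [hz]
      push_cast
      linear_combination (-2 * Real.pi * ε * ω) * Complex.I_sq
    · simp only [hG, cutoff, indicator_of_notMem hω, smul_eq_mul, mul_zero]
  have hre : (2 * Real.pi * I * (z - t)).re < 0 := by
    have : 0 < 2 * Real.pi * z.im := by positivity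
    simpa using this
  have hne := sub_ofReal_ne_zero_of_im_pos hzi t
  have hne' : z - (t : ℂ) ≠ 0 := fun h => hne (by rw [← neg_sub, h, neg_zero])
  have hpi : (2 * Real.pi * I : ℂ) ≠ 0 := by simp [Real.pi_ne_zero]
  simp only
  rw [e2, integral_exp_mul_complex_Ioi hre]
  simp only [Complex.ofReal_zero, mul_zero, Complex.exp_zero]
  rw [← neg_sub z (t : ℂ), inv_neg, mul_comm (h t), ← mul_assoc, neg_div, one_div, mul_inv,
    mul_neg]

/-- The Cauchy integrals of `h` at height `u n` converge to the Riesz projection of `h` almost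
everywhere along a subsequence. -/
lemma exists_seq_tendsto_cauchy {h : ℝ → ℂ} (h1 : Integrable h) (h2 : MemLp h 2) {u : ℕ → ℝ}
    (hu0 : ∀ n, 0 < u n) (hu : Tendsto u atTop (𝓝 0)) :
    ∃ ns : ℕ → ℕ, StrictMono ns ∧ ∀ᵐ x,
      Tendsto (fun k => cauchy h (u (ns k)) x) atTop (𝓝 (rieszProj (h2.toLp h) x)) := by
  obtain ⟨ns, hns, h⟩ := exists_seq_tendsto_fourierInv_mul h1 h2
    (fun n => integrable_cutoff (hu0 n)) (fun n => norm_cutoff_le (hu0 n))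
    (ae_of_all _ (tendsto_cutoff hu)) (Q := rieszProj (h2.toLp h)) (by
      filter_upwards [fourier_rieszProj (h2.toLp h)] with ω e
      rw [e]
      by_cases hω : ω ∈ Ioi (0 : ℝ)
      · simp [indicator_of_mem hω]
      · simp [indicator_of_notMem hω])
  exact ⟨ns, hns, by simpa only [fourierInv_cutoff_mul h1 (hu0 _)] using h⟩

lemma exists_pos_seq_tendsto_zero : ∃ u : ℕ → ℝ, (∀ n, 0 < u n) ∧ Tendsto u atTop (𝓝 0) :=
  ⟨fun n => 1 / ((n : ℝ) + 1), fun n => by positivity, tendsto_one_div_add_atTop_nhds_zero_nat⟩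

/-- Commutator of the Riesz projection with multiplication by the independent variable. -/
lemma ofReal_mul_rieszProj {h k : ℝ → ℂ} (h1 : Integrable h) (h2 : MemLp h 2)
    (k1 : Integrable k) (k2 : MemLp k 2) (hk : ∀ᵐ x : ℝ, k x = x * h x) :
    ∀ᵐ x : ℝ, (x : ℂ) * rieszProj (h2.toLp h) x - rieszProj (k2.toLp k) x =
      -((2 * Real.pi * I)⁻¹ * ∫ t, h t) := by
  obtain ⟨u, hu0, hu⟩ := exists_pos_seq_tendsto_zero
  obtain ⟨ns, hns, hae⟩ := exists_seq_tendsto_cauchy h1 h2 hu0 hu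
  -- The second subsequence is extracted from the first, so that both Cauchy integrals converge
  -- along it.
  obtain ⟨ms, hms, hae'⟩ := exists_seq_tendsto_cauchy k1 k2 (fun n => hu0 (ns n))
    (hu.comp hns.tendsto_atTop)
  -- At positive height the identity is exact, since `z/(t - z) - t/(t - z) = -1`.
  have key : ∀ n (x : ℝ), ((x : ℂ) + u n * I) * cauchy h (u n) x - cauchy k (u n) x =
      -((2 * Real.pi * I)⁻¹ * ∫ t, h t) := by
    intro n x
    set z : ℂ := x + u n * I with hz
    have hzi : 0 < z.im := by simpa [hz] using hu0 n
    have hb : ∀ {f : ℝ → ℂ}, Integrable f → Integrable fun t : ℝ => f t * ((t : ℂ) - z)⁻¹ :=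
      fun hf => hf.mul_bdd (c := z.im⁻¹) (continuous_inv_ofReal_sub hzi).aestronglyMeasurable
        (ae_of_all _ (norm_inv_ofReal_sub_le hzi))
    rw [cauchy, cauchy, ← hz, mul_left_comm, ← mul_sub, ← integral_const_mul,
      ← integral_sub ((hb h1).const_mul z) (hb k1), ← mul_neg, ← integral_neg]
    congr 1
    refine integral_congr_ae ?_
    filter_upwards [hk] with t ht
    have hne := sub_ofReal_ne_zero_of_im_pos hzi t
    rw [ht]
    field_simp
    ring
  filter_upwards [hae, hae'] with x e1 e2
  have e1' := e1.comp hms.tendsto_atTop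
  have hu' : Tendsto (fun n => (x : ℂ) + u (ns (ms n)) * I) atTop (𝓝 (x : ℂ)) := by
    have h := (Complex.continuous_ofReal.tendsto 0).comp
      ((hu.comp hns.tendsto_atTop).comp hms.tendsto_atTop)
    have := (h.mul_const I).const_add (x : ℂ)
    simpa [Function.comp_def] using this
  have hT := (hu'.mul e1').sub e2
  refine tendsto_nhds_unique hT ?_
  simp only [Function.comp_def, key]
  exact tendsto_const_nhds

lemma conj_fourier_of_real {h : ℝ → ℂ} (hr : ∀ x, conj (h x) = h x) (ω : ℝ) :
    conj (𝓕 h ω) = 𝓕 h (-ω) := by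
  rw [Real.fourier_real_eq_integral_exp_smul, Real.fourier_real_eq_integral_exp_smul,
    ← integral_conj]
  refine integral_congr_ae (ae_of_all _ fun t => ?_)
  simp only [smul_eq_mul, map_mul, hr, ← Complex.exp_conj]
  simp [map_ofNat]

lemma conj_cutoff (ε ω : ℝ) : conj (cutoff ε ω) = cutoff ε ω := by
  by_cases hω : ω ∈ Ioi (0 : ℝ)
  · simp only [cutoff, indicator_of_mem hω, ← Complex.exp_conj]
    simp [map_ofNat]
  · simp only [cutoff, indicator_of_notMem hω, map_zero]

/-- Conjugation reflects the spectrum, turning the cutoff on the positive half-line into one on the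
negative half-line. -/
lemma conj_fourierInv_cutoff_mul {h : ℝ → ℂ} (hr : ∀ x, conj (h x) = h x) (ε x : ℝ) :
    conj (𝓕⁻ (fun ω => cutoff ε ω * 𝓕 h ω) x) = 𝓕⁻ (fun ω => cutoff ε (-ω) * 𝓕 h ω) x := by
  rw [Real.fourierInv_eq', Real.fourierInv_eq', ← integral_conj, ← integral_neg_eq_self]
  refine integral_congr_ae (ae_of_all _ fun t => ?_)
  simp only [smul_eq_mul, map_mul, conj_cutoff, conj_fourier_of_real hr, ← Complex.exp_conj]
  simp [map_ofNat]

lemma integrable_exp_smul {φ : ℝ → ℂ} (hφ : Integrable φ) (x : ℝ) :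
    Integrable fun ω : ℝ => cexp (((2 * Real.pi * inner ℝ ω x : ℝ) : ℂ) * I) • φ ω :=
  hφ.bdd_mul (c := 1) (Continuous.aestronglyMeasurable (by fun_prop))
    (ae_of_all _ fun ω => (Complex.norm_exp_ofReal_mul_I _).le)

/-- For real `h` the Riesz projection and its complex conjugate add up to `h`. -/
lemma rieszProj_add_conj {h : ℝ → ℂ} (h1 : Integrable h) (h2 : MemLp h 2)
    (hr : ∀ x, conj (h x) = h x) :
    ∀ᵐ x : ℝ, rieszProj (h2.toLp h) x + conj (rieszProj (h2.toLp h) x) = h x := by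
  obtain ⟨u, hu0, hu⟩ := exists_pos_seq_tendsto_zero
  obtain ⟨ns, hns, hae⟩ := exists_seq_tendsto_cauchy h1 h2 hu0 hu
  have hF := continuous_fourier_of_integrable h1
  have hi : ∀ n, Integrable fun ω => cutoff (u n) (-ω) := fun n =>
    (integrable_cutoff (hu0 n)).comp_neg
  have h0 : ∀ᵐ ω : ℝ, ω ≠ 0 := by simp [ae_iff]
  -- The two half-line cutoffs have disjoint supports, so their sum is still bounded by `1`; it
  -- tends to `1` off the origin and therefore recovers `h` itself.
  obtain ⟨ms, hms, hae'⟩ := exists_seq_tendsto_fourierInv_mul h1 h2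
    (ψ := fun n ω => cutoff (u (ns n)) ω + cutoff (u (ns n)) (-ω)) (ψlim := fun _ => 1)
    (fun n => (integrable_cutoff (hu0 _)).add (hi _))
    (fun n ω => by
      rcases le_or_gt ω 0 with hω | hω
      · have : cutoff (u (ns n)) ω = 0 := indicator_of_notMem (not_lt.2 hω) _
        rw [this, zero_add]
        exact norm_cutoff_le (hu0 _) _
      · have : cutoff (u (ns n)) (-ω) = 0 :=
          indicator_of_notMem (fun h => by simp only [mem_Ioi] at h; linarith) _
        rw [this, add_zero]
        exact norm_cutoff_le (hu0 _) _)
    (by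
      filter_upwards [h0] with ω hω
      have hu' := hu.comp hns.tendsto_atTop
      have hT := (tendsto_cutoff hu' ω).add (tendsto_cutoff hu' (-ω))
      have e : (Ioi (0 : ℝ)).indicator (1 : ℝ → ℂ) ω + (Ioi (0 : ℝ)).indicator 1 (-ω) = 1 := by
        rcases lt_or_gt_of_ne hω with h | h
        · rw [indicator_of_notMem (show ω ∉ Ioi (0 : ℝ) from not_lt.2 h.le),
            indicator_of_mem (show -ω ∈ Ioi (0 : ℝ) by simpa using h)]
          simp
        · rw [indicator_of_mem (mem_Ioi.2 h),
            indicator_of_notMem (show -ω ∉ Ioi (0 : ℝ) by simpa using h.le)]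
          simp
      rwa [e] at hT)
    (Q := h2.toLp h) (by simp)
  filter_upwards [hae, hae', h2.coeFn_toLp] with x e1 e2 e3
  rw [e3] at e2
  have e1' := e1.comp hms.tendsto_atTop
  refine tendsto_nhds_unique (e1'.add ((Complex.continuous_conj.tendsto _).comp e1')) ?_
  refine e2.congr fun n => ?_
  have hb : ∀ {φ : ℝ → ℂ}, Integrable φ → Integrable fun ω => φ ω * 𝓕 h ω := fun hφ =>
    hφ.mul_bdd (c := ∫ x, ‖h x‖) hF.aestronglyMeasurable (ae_of_all _ (norm_fourier_le h))
  simp only [Function.comp_apply]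
  rw [← fourierInv_cutoff_mul h1 (hu0 _), conj_fourierInv_cutoff_mul hr]
  simp only [Real.fourierInv_eq']
  rw [← integral_add]
  · simp only [add_mul, smul_add]
  · exact integrable_exp_smul (hb (integrable_cutoff (hu0 _))) x
  · exact integrable_exp_smul (hb (hi _)) x

end

/-! ### Multipliers of the Hardy space -/

/-- The character `x ↦ exp(2πiωx)`. -/
noncomputable def character (ω : ℝ) (x : ℝ) : ℂ := cexp (((2 * Real.pi * (x * ω) : ℝ) : ℂ) * I)

lemma norm_character (ω x : ℝ) : ‖character ω x‖ = 1 := Complex.norm_exp_ofReal_mul_I _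

lemma continuous_character (ω : ℝ) : Continuous (character ω) := by
  unfold character
  fun_prop

lemma memLp_top_character (ω : ℝ) : MemLp (character ω) ∞ (volume : Measure ℝ) :=
  memLp_top_of_bound (continuous_character ω).aestronglyMeasurable 1
    (ae_of_all _ fun x => (norm_character ω x).le)

lemma IsMulOp.coeFn {μ ν : Measure ℝ} {φ : ℝ → ℂ} {T : Lp ℂ 2 μ →L[ℂ] Lp ℂ 2 ν}
    (hT : IsMulOp μ ν φ T) (f : Lp ℂ 2 μ) : T f =ᵐ[ν] fun x => φ x * f x := by
  have h := hT f (Lp.memLp f)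
  rwa [Lp.toLp_coeFn] at h

lemma fourier_character_mul (f : ℝ → ℂ) (ω ξ : ℝ) :
    𝓕 (fun x => character ω x * f x) ξ = 𝓕 f (ξ - ω) := by
  rw [Real.fourier_real_eq_integral_exp_smul, Real.fourier_real_eq_integral_exp_smul]
  refine integral_congr_ae (ae_of_all _ fun x => ?_)
  simp only [smul_eq_mul, character, ← mul_assoc, ← Complex.exp_add]
  congr 2
  push_cast
  ring

/-- Multiplication by a character translates the Fourier transform. -/
lemma fourier_mulOp_character (ω : ℝ) (f : L2) :
    (𝓕 (mulOp volume volume (character ω) f) : L2) =ᵐ[volume]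
      fun ξ => (𝓕 f : L2) (ξ - ω) := by
  have hE := isMulOp_of_memLp_top (memLp_top_character ω)
  set E := mulOp volume volume (character ω)
  have hmp : MeasurePreserving (fun ξ : ℝ => ξ - ω) volume volume :=
    measurePreserving_sub_right volume ω
  have key : ∀ f : L2, Lp.fourierTransformₗᵢ ℝ ℂ (E f) =
      Lp.compMeasurePreservingₗᵢ ℂ _ hmp (Lp.fourierTransformₗᵢ ℝ ℂ f) := by
    intro f
    -- Both sides are continuous in `f`, so Schwartz functions suffice, and for them the Fourier
    -- integral can be computed.
    refine DenseRange.induction_on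
      (p := fun f : L2 => Lp.fourierTransformₗᵢ ℝ ℂ (E f) =
        Lp.compMeasurePreservingₗᵢ ℂ _ hmp (Lp.fourierTransformₗᵢ ℝ ℂ f))
      (SchwartzMap.denseRange_toLpCLM (F := ℂ) (E := ℝ) (p := 2) (μ := volume)
        ENNReal.ofNat_ne_top) f ?_ ?_
    · exact isClosed_eq ((Lp.fourierTransformₗᵢ ℝ ℂ).continuous.comp E.continuous)
        ((Lp.compMeasurePreservingₗᵢ ℂ _ hmp).continuous.comp
          (Lp.fourierTransformₗᵢ ℝ ℂ).continuous)
    · intro φ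
      have hφ2 : MemLp φ 2 (volume : Measure ℝ) := φ.memLp 2 volume
      have hm : AEStronglyMeasurable (fun x => character ω x * φ x) (volume : Measure ℝ) :=
        ((continuous_character ω).mul φ.continuous).aestronglyMeasurable
      have hn : ∀ x, ‖character ω x * φ x‖ ≤ ‖φ x‖ := fun x => by
        rw [norm_mul, norm_character, one_mul]
      have h1 : Integrable (fun x => character ω x * φ x) (volume : Measure ℝ) :=
        φ.integrable.mono hm (ae_of_all _ hn)
      have h2 : MemLp (fun x => character ω x * φ x) 2 (volume : Measure ℝ) :=
        hφ2.mono hm (ae_of_all _ hn)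
      have e1 : E (SchwartzMap.toLpCLM ℝ ℂ 2 volume φ) = h2.toLp _ := by
        refine Lp.ext ((hE φ hφ2).trans h2.coeFn_toLp.symm)
      have e2 : Lp.fourierTransformₗᵢ ℝ ℂ (SchwartzMap.toLpCLM ℝ ℂ 2 volume φ) =
          (𝓕 φ).toLp 2 := SchwartzMap.toLp_fourier_eq φ
      rw [e1, e2]
      refine Lp.ext ?_
      refine (fourier_toLp_ae_eq h1 h2).trans ?_
      refine EventuallyEq.trans ?_ (Lp.coeFn_compMeasurePreserving _ hmp).symm
      have e3 := hmp.quasiMeasurePreserving.ae_eq_comp ((𝓕 φ).coeFn_toLp 2 volume)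
      refine EventuallyEq.trans ?_ e3.symm
      refine Eventually.of_forall fun ξ => ?_
      rw [fourier_character_mul, Function.comp_apply, SchwartzMap.fourier_coe]
  have h := key f
  change (Lp.fourierTransformₗᵢ ℝ ℂ (E f) : L2) =ᵐ[volume] _
  rw [h]
  exact Lp.coeFn_compMeasurePreserving _ hmp

lemma mulOp_character_mem_hardySpace {ω : ℝ} (hω : 0 ≤ ω) {k : L2} (hk : k ∈ hardySpace) :
    mulOp volume volume (character ω) k ∈ hardySpace := by
  have hk' : ∀ᵐ ξ ∂(volume : Measure ℝ), ξ < 0 → (𝓕 k : L2) ξ = 0 := hk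
  change ∀ᵐ ξ ∂(volume : Measure ℝ), ξ < 0 → _
  have h := (measurePreserving_sub_right volume ω).quasiMeasurePreserving.ae hk'
  filter_upwards [fourier_mulOp_character ω k, h] with ξ e1 e2 hξ
  rw [e1, e2 (by linarith)]

lemma integrable_conj_mul (m k : L2) : Integrable (fun x : ℝ => conj (m x) * k x) := by
  have h := L2.integrable_inner (𝕜 := ℂ) m k
  simpa only [RCLike.inner_apply, mul_comm] using h

lemma inner_eq_integral_conj_mul {μ : Measure ℝ} (m k : Lp ℂ 2 μ) :
    inner ℂ m k = ∫ x, conj (m x) * k x ∂μ := by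
  rw [L2.inner_def]
  simp only [RCLike.inner_apply, mul_comm]

/-- If `m` is orthogonal to the Hardy space and `k` belongs to it then the spectrum of `m̄ k`
lies in a half-line. -/
lemma fourierInv_conj_mul_eq_zero {m k : L2} (hm : m ∈ hardySpaceᗮ) (hk : k ∈ hardySpace)
    {ω : ℝ} (hω : 0 ≤ ω) : 𝓕⁻ (fun x => conj (m x) * k x) ω = 0 := by
  -- The value at `ω` is the inner product of `m` with `exp(2πiωx) k`, which stays in the Hardy
  -- space for `ω ≥ 0`.
  have h0 := Submodule.inner_left_of_mem_orthogonal (mulOp_character_mem_hardySpace hω hk) hm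
  rw [← h0, inner_eq_integral_conj_mul, Real.fourierInv_eq']
  refine integral_congr_ae ?_
  filter_upwards [(isMulOp_of_memLp_top (memLp_top_character ω)).coeFn k] with x e
  rw [e]
  simp only [smul_eq_mul, character, RCLike.inner_apply, conj_trivial]
  rw [mul_comm ω x]
  ring

/-- A Riesz projection whose Cauchy integrals are uniformly bounded is a multiplier of the Hardy
space. -/
lemma integral_conj_mul_rieszProj_mul_eq_zero {h : ℝ → ℂ} (h1 : Integrable h) (h2 : MemLp h 2)
    {K : ℝ} (hK : ∀ ε > 0, ∀ x, ‖cauchy h ε x‖ ≤ K)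
    {m k : L2} (hm : m ∈ hardySpaceᗮ) (hk : k ∈ hardySpace) :
    ∫ x, rieszProj (h2.toLp h) x * (conj (m x) * k x) = 0 := by
  obtain ⟨u, hu0, hu⟩ := exists_pos_seq_tendsto_zero
  obtain ⟨ns, hns, hae⟩ := exists_seq_tendsto_cauchy h1 h2 hu0 hu
  have hF := continuous_fourier_of_integrable h1
  have hb : ∀ n, Integrable fun ω => cutoff (u n) ω * 𝓕 h ω := fun n =>
    (integrable_cutoff (hu0 n)).mul_bdd (c := ∫ x, ‖h x‖) hF.aestronglyMeasurable
      (ae_of_all _ (norm_fourier_le h))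
  have hg := integrable_conj_mul m k
  have hc : ∀ n, cauchy h (u n) = 𝓕⁻ (fun ω => cutoff (u n) ω * 𝓕 h ω) := fun n =>
    funext fun x => (fourierInv_cutoff_mul h1 (hu0 n) x).symm
  -- By Fourier duality this is the integral of `cutoff · 𝓕 h`, supported in `ω > 0`, against `𝓕⁻(m̄
  -- k)`, which vanishes for `ω ≥ 0`.
  have hz : ∀ n, ∫ x, cauchy h (u n) x * (conj (m x) * k x) = 0 := by
    intro n
    rw [hc, integral_fourierInv_mul_eq (hb n) hg, ← integral_zero ℝ ℂ]
    refine integral_congr_ae (ae_of_all _ fun ω => ?_)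
    by_cases hω : ω ∈ Ioi (0 : ℝ)
    · simp only [fourierInv_conj_mul_eq_zero hm hk (le_of_lt hω), mul_zero]
    · simp only [cutoff, indicator_of_notMem hω, zero_mul]
  have hT := tendsto_integral_of_dominated_convergence
    (F := fun n x => cauchy h (u (ns n)) x * (conj (m x) * k x))
    (f := fun x => rieszProj (h2.toLp h) x * (conj (m x) * k x))
    (μ := volume) (fun x => K * ‖conj (m x) * k x‖)
    (fun n => by
      rw [hc]
      exact (continuous_fourierInv_of_integrable (hb _)).aestronglyMeasurable.mul hg.1)
    (hg.norm.const_mul K)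
    (fun n => ae_of_all _ fun x => by
      rw [norm_mul]
      exact mul_le_mul_of_nonneg_right (hK _ (hu0 _) x) (norm_nonneg _))
    (by filter_upwards [hae] with x e using e.mul_const _)
  simp only [hz] at hT
  exact (tendsto_nhds_unique hT tendsto_const_nhds)

lemma norm_rieszProj_le {h : ℝ → ℂ} (h1 : Integrable h) (h2 : MemLp h 2)
    {K : ℝ} (hK : ∀ ε > 0, ∀ x, ‖cauchy h ε x‖ ≤ K) :
    ∀ᵐ x, ‖rieszProj (h2.toLp h) x‖ ≤ K := by
  obtain ⟨u, hu0, hu⟩ := exists_pos_seq_tendsto_zero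
  obtain ⟨ns, hns, hae⟩ := exists_seq_tendsto_cauchy h1 h2 hu0 hu
  filter_upwards [hae] with x e
  exact le_of_tendsto e.norm (Eventually.of_forall fun n => hK _ (hu0 _) x)

/-- The Hardy space is its own double orthogonal complement, so membership is tested against each
`m` orthogonal to it. -/
lemma IsMulOp.mem_hardySpace {h : ℝ → ℂ} (h1 : Integrable h) (h2 : MemLp h 2)
    {K : ℝ} (hK : ∀ ε > 0, ∀ x, ‖cauchy h ε x‖ ≤ K) {T : L2 →L[ℂ] L2}
    (hT : IsMulOp volume volume (rieszProj (h2.toLp h)) T) {k : L2} (hk : k ∈ hardySpace) :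
    T k ∈ hardySpace := by
  rw [← Submodule.orthogonal_orthogonal hardySpace, Submodule.mem_orthogonal]
  intro m hm
  rw [inner_eq_integral_conj_mul, ← integral_conj_mul_rieszProj_mul_eq_zero h1 h2 hK hm hk]
  refine integral_congr_ae ?_
  filter_upwards [hT.coeFn k] with x e
  rw [e]
  ring

lemma norm_cauchy_density_le {ρ : Measure ℝ} [IsFiniteMeasure ρ] (hac : ρ ≪ volume) {C : ℝ}
    (hC : ∀ z : ℂ, 0 < z.im → ‖borelTransform ρ z‖ ≤ C) :
    ∀ ε > 0, ∀ x, ‖cauchy (density ρ) ε x‖ ≤ (2 * Real.pi)⁻¹ * C := by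
  intro ε hε x
  rw [cauchy, integral_density_mul ρ hac, norm_mul]
  have e : ‖(2 * Real.pi * I : ℂ)⁻¹‖ = (2 * Real.pi)⁻¹ := by
    simp [abs_of_pos Real.pi_pos]
  rw [e]
  refine mul_le_mul_of_nonneg_left (hC (x + ε * I) (by simpa using hε)) (by positivity)

/-! ### The embedding operator and its adjoint -/

/-- Carries `ρ`-almost everywhere identities over to Lebesgue measure inside expressions containing
the factor `density ρ`. -/
lemma ae_density_eq_zero_or {ρ : Measure ℝ} [IsFiniteMeasure ρ] (hac : ρ ≪ volume) {p : ℝ → Prop}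
    (hp : ∀ᵐ x ∂ρ, p x) : ∀ᵐ x : ℝ, density ρ x = 0 ∨ p x := by
  rw [← Measure.withDensity_rnDeriv_eq ρ volume hac,
    ae_withDensity_iff (Measure.measurable_rnDeriv _ _)] at hp
  filter_upwards [hp] with x hx
  by_cases h : ρ.rnDeriv volume x = 0
  · left
    simp [density, h]
  · exact Or.inr (hx h)

lemma IsMulOp.congr {μ ν : Measure ℝ} {φ φ' : ℝ → ℂ} {T : Lp ℂ 2 μ →L[ℂ] Lp ℂ 2 ν}
    (hT : IsMulOp μ ν φ T) (h : φ =ᵐ[ν] φ') : IsMulOp μ ν φ' T := by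
  intro f hf
  filter_upwards [hT f hf, h] with x e1 e2
  rw [e1, e2]

/-- If `ρ` is dominated by a multiple of the Lebesgue measure then the embedding operator is
bounded. -/
lemma isMulOp_opJ_of_le {ρ : Measure ℝ} {C : ℝ≥0∞} (hC : C ≠ ∞) (h : ρ ≤ C • volume) :
    IsMulOp volume ρ (fun _ => 1) (opJ ρ) := by
  have hac : ρ ≪ volume := Measure.absolutelyContinuous_of_le_smul h
  have hm : ∀ {f : ℝ → ℂ}, MemLp f 2 volume → MemLp f 2 ρ := fun hf =>
    hf.of_measure_le_smul hC h
  -- Scaling a measure by `C` scales the L² norm by `C^(1/2)`.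
  set K := C ^ (1 / (2 : ℝ≥0∞)).toReal with hK
  have hKt : K ≠ ∞ := ENNReal.rpow_ne_top_of_nonneg ENNReal.toReal_nonneg hC
  let L : L2 →ₗ[ℂ] Lp ℂ 2 ρ :=
    { toFun := fun f => (hm (Lp.memLp f)).toLp f
      map_add' := fun f k => by
        refine Lp.ext ?_
        refine (MemLp.coeFn_toLp _).trans ?_
        filter_upwards [hac.ae_le (Lp.coeFn_add f k), (hm (Lp.memLp f)).coeFn_toLp,
          (hm (Lp.memLp k)).coeFn_toLp,
          Lp.coeFn_add ((hm (Lp.memLp f)).toLp f) ((hm (Lp.memLp k)).toLp k)] with x e1 e2 e3 e4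
        rw [e1, e4, Pi.add_apply, Pi.add_apply, e2, e3]
      map_smul' := fun c f => by
        refine Lp.ext ?_
        refine (MemLp.coeFn_toLp _).trans ?_
        filter_upwards [hac.ae_le (Lp.coeFn_smul c f), (hm (Lp.memLp f)).coeFn_toLp,
          Lp.coeFn_smul c ((hm (Lp.memLp f)).toLp f)] with x e1 e2 e3
        rw [e1, RingHom.id_apply, e3, Pi.smul_apply, Pi.smul_apply, e2] }
  have hL : ∀ f, ‖L f‖ ≤ K.toReal * ‖f‖ := by
    intro f
    change ‖(hm (Lp.memLp f)).toLp f‖ ≤ _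
    rw [Lp.norm_toLp, Lp.norm_def, ← ENNReal.toReal_mul]
    refine ENNReal.toReal_mono (ENNReal.mul_ne_top hKt (Lp.memLp f).2.ne) ?_
    refine (eLpNorm_mono_measure _ h).trans ?_
    rw [eLpNorm_smul_measure_of_ne_top (by norm_num)]
    rfl
  have key : IsMulOp volume ρ (fun _ => 1) (L.mkContinuous _ hL) := by
    intro f hf
    simp only [one_mul]
    exact (MemLp.coeFn_toLp (hm (Lp.memLp (hf.toLp f)))).trans (hac.ae_le hf.coeFn_toLp)
  rw [opJ, key.mulOp_eq]
  exact key

lemma conj_density {ρ : Measure ℝ} (x : ℝ) : conj (density ρ x) = density ρ x :=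
  Complex.conj_ofReal _

lemma inner_opJ {ρ : Measure ℝ} (hJ : IsMulOp volume ρ (fun _ => 1) (opJ ρ))
    (k : Lp ℂ 2 ρ) (f : L2) :
    inner ℂ k (opJ ρ f) = ∫ x, conj (k x) * f x ∂ρ := by
  rw [inner_eq_integral_conj_mul]
  refine integral_congr_ae ?_
  filter_upwards [hJ.coeFn f] with x e
  rw [e, one_mul]

lemma densityL2_eq {ρ : Measure ℝ} (h : MemLp (density ρ) 2 volume) :
    densityL2 ρ = h.toLp (density ρ) := by
  rw [densityL2, dif_pos h]

section Density

variable {ρ : Measure ℝ} [IsFiniteMeasure ρ] {C : ℝ}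

lemma integrable_density_mul (hac : ρ ≪ volume) {f : ℝ → ℂ} (hf : MemLp f 2 ρ) :
    Integrable (fun x => density ρ x * f x) :=
  (integrable_density_mul_iff ρ hac).2 (hf.integrable (by norm_num))

lemma memLp_two_density_mul (hC : 0 ≤ C) (h : ρ ≤ ENNReal.ofReal C • volume) {f : ℝ → ℂ}
    (hf : MemLp f 2 ρ) : MemLp (fun x => density ρ x * f x) 2 := by
  have hac : ρ ≪ volume := Measure.absolutelyContinuous_of_le_smul h
  have hi := integrable_density_mul hac hf
  rw [memLp_two_iff_integrable_sq_norm hi.1]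
  have h2 : Integrable (fun x => density ρ x * ((‖f x‖ ^ 2 : ℝ) : ℂ)) :=
    (integrable_density_mul_iff ρ hac).2
      ((memLp_two_iff_integrable_sq_norm hf.1).1 hf).ofReal
  refine (h2.norm.const_mul C).mono' (hi.1.norm.pow 2) ?_
  filter_upwards [norm_density_le ρ hC h] with x hx
  rw [norm_pow, norm_norm, norm_mul, norm_mul, Complex.norm_real, norm_pow, norm_norm, mul_pow,
    sq ‖density ρ x‖, mul_assoc]
  exact mul_le_mul_of_nonneg_right hx (by positivity)

/-- The adjoint of the embedding operator is multiplication by the density. -/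
lemma isMulOp_adjoint_opJ (hC : 0 ≤ C) (h : ρ ≤ ENNReal.ofReal C • volume) :
    IsMulOp ρ volume (density ρ) (opJ ρ).adjoint := by
  have hac : ρ ≪ volume := Measure.absolutelyContinuous_of_le_smul h
  have hJ := isMulOp_opJ_of_le ENNReal.ofReal_ne_top h
  intro f hf
  have hm := memLp_two_density_mul hC h hf
  have e : (opJ ρ).adjoint (hf.toLp f) = hm.toLp _ := by
    refine ext_inner_right ℂ fun k => ?_
    rw [ContinuousLinearMap.adjoint_inner_left, inner_opJ hJ, inner_eq_integral_conj_mul,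
      ← integral_density_mul ρ hac]
    refine integral_congr_ae ?_
    filter_upwards [hm.coeFn_toLp, ae_density_eq_zero_or hac hf.coeFn_toLp] with x e1 e2
    rw [e1, map_mul, conj_density, mul_assoc]
    rcases e2 with e2 | e2
    · rw [e2, zero_mul, zero_mul]
    · rw [e2]
  rw [e]
  exact hm.coeFn_toLp

lemma adjoint_opJ_toLp (hC : 0 ≤ C) (h : ρ ≤ ENNReal.ofReal C • volume) {f : ℝ → ℂ}
    (hf : MemLp f 2 ρ) {k : ℝ → ℂ} (hk : MemLp k 2)
    (hkf : k =ᵐ[volume] fun x => density ρ x * f x) :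
    (opJ ρ).adjoint (hf.toLp f) = hk.toLp k :=
  Lp.ext ((isMulOp_adjoint_opJ hC h f hf).trans (hkf.symm.trans hk.coeFn_toLp.symm))

/-- The real part of multiplication by the Riesz projection of the density is half of
multiplication by the density. -/
lemma add_adjoint_mulOp_rieszProj (hC : 0 ≤ C) (h : ρ ≤ ENNReal.ofReal C • volume) {G : L2 →L[ℂ] L2}
    (hG : IsMulOp volume volume (rieszProj (densityL2 ρ)) G) :
    G + star G = (opJ ρ).adjoint ∘L opJ ρ := by
  have hac : ρ ≪ volume := Measure.absolutelyContinuous_of_le_smul h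
  have hJ := isMulOp_opJ_of_le ENNReal.ofReal_ne_top h
  ext1 f
  refine ext_inner_left ℂ fun k => ?_
  have hd := memLp_two_density ρ hC h
  rw [ContinuousLinearMap.comp_apply, ContinuousLinearMap.adjoint_inner_right, inner_opJ hJ,
    _root_.add_apply, inner_add_right, ContinuousLinearMap.star_eq_adjoint,
    ContinuousLinearMap.adjoint_inner_right, inner_eq_integral_conj_mul,
    inner_eq_integral_conj_mul, ← integral_add (integrable_conj_mul _ _) (integrable_conj_mul _ _)]
  have e0 : ∫ x, conj ((opJ ρ k) x) * f x ∂ρ = ∫ x, conj (k x) * f x ∂ρ := by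
    refine integral_congr_ae ?_
    filter_upwards [hJ.coeFn k] with x e
    rw [e, one_mul]
  rw [e0, ← integral_density_mul ρ hac]
  refine integral_congr_ae ?_
  have hp := rieszProj_add_conj (integrable_density ρ) hd conj_density
  rw [← densityL2_eq hd] at hp
  filter_upwards [hG.coeFn f, hG.coeFn k, hp] with x e1 e2 e3
  rw [e1, e2, ← e3, map_mul]
  ring

end Density

/-! ### Operator algebra -/

/-- Neumann series: if `t` preserves the closed subspace `W` and `‖t‖ < 1` then so does the
inverse of `1 - t`. -/
lemma inverse_one_sub_mem {H : Type*} [NormedAddCommGroup H] [NormedSpace ℂ H] [CompleteSpace H]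
    {t : H →L[ℂ] H} (ht : ‖t‖ < 1) {W : Submodule ℂ H} (hW : IsClosed (W : Set H))
    (htW : ∀ k ∈ W, t k ∈ W) {k : H} (hk : k ∈ W) : Ring.inverse (1 - t) k ∈ W := by
  have hs := (summable_geometric_of_norm_lt_one ht).hasSum
  have e : Ring.inverse (1 - t) = ∑' n : ℕ, t ^ n := by
    rw [NormedRing.inverse_one_sub t ht]
    rfl
  rw [e]
  have hs' := hs.mapL (ContinuousLinearMap.apply ℂ H k)
  simp only [ContinuousLinearMap.apply_apply] at hs'
  refine hW.mem_of_tendsto hs' (Eventually.of_forall fun s => ?_)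
  refine Submodule.sum_mem _ fun n hn => ?_
  clear hn
  induction n with
  | zero => simpa using hk
  | succ n ih =>
    rw [pow_succ']
    exact htW _ ih

/-- The algebraic identity behind unitarity. -/
lemma isometry_of_add_star {H K : Type*} [NormedAddCommGroup H] [InnerProductSpace ℂ H]
    [CompleteSpace H] [NormedAddCommGroup K] [InnerProductSpace ℂ K] [CompleteSpace K]
    {S : K →L[ℂ] H} {G Ψ P : K →L[ℂ] K} {b : ℂ} (hb : conj b = -b)
    (hG : G + star G = S.adjoint ∘L S) (hP : star P = P)
    (hD : (1 + b • G) * Ψ = 1) (hΨ : P * Ψ * P = Ψ * P) :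
    star (1 - b • (S ∘L Ψ ∘L P ∘L S.adjoint)) * (1 - b • (S ∘L Ψ ∘L P ∘L S.adjoint)) = 1 := by
  set X := S ∘L Ψ ∘L P ∘L S.adjoint with hX
  have hXs : star X = S ∘L (P * star Ψ) ∘L S.adjoint := by
    rw [hX, ContinuousLinearMap.star_eq_adjoint, ContinuousLinearMap.adjoint_comp,
      ContinuousLinearMap.adjoint_comp, ContinuousLinearMap.adjoint_comp,
      ContinuousLinearMap.adjoint_adjoint]
    rw [ContinuousLinearMap.star_eq_adjoint] at hP
    rw [hP]
    rfl
  have hDs : star (1 + b • G) = 1 - b • star G := by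
    rw [star_add, star_one, star_smul, Complex.star_def, hb, neg_smul, sub_eq_add_neg]
  have h1s : star Ψ * (1 - b • star G) = 1 := by rw [← hDs, ← star_mul, hD, star_one]
  have hΨs : P * star Ψ * P = P * star Ψ := by
    have := congrArg star hΨ
    simpa only [star_mul, hP, mul_assoc] using this
  -- As `b` is imaginary, `b(G + G*) = D - D*` with `D = 1 + bG`; sandwiching between `Ψ*` and `Ψ`
  -- cancels each of `D` and `D*` in turn.
  have hZ : b • (star Ψ * (G + star G) * Ψ) = star Ψ - Ψ := by
    have : b • (G + star G) = (1 + b • G) - (1 - b • star G) := by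
      rw [smul_add]; abel
    rw [← smul_mul_assoc, ← mul_smul_comm, this, mul_sub, sub_mul, mul_assoc, hD, mul_one, h1s,
      one_mul]
  -- Compressing `hZ` by `P` and using the invariance `PΨP = ΨP` turns it into a relation for `X`,
  -- which is exactly the cancellation needed in `(1 - bX)*(1 - bX)`.
  have hXX : b • (star X * X) = star X - X := by
    have e1 : star X * X = S ∘L (P * (star Ψ * (G + star G) * Ψ) * P) ∘L S.adjoint := by
      rw [hXs, hG, hX]
      rfl
    have e2 : b • (P * (star Ψ * (G + star G) * Ψ) * P) = P * star Ψ - Ψ * P := by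
      rw [← smul_mul_assoc, ← mul_smul_comm, hZ, mul_sub, sub_mul, hΨs, hΨ]
    rw [e1, ← ContinuousLinearMap.comp_smul, ← ContinuousLinearMap.smul_comp, e2,
      ContinuousLinearMap.sub_comp, ContinuousLinearMap.comp_sub, ← hXs, hX]
    rfl
  rw [star_sub, star_one, star_smul, Complex.star_def, hb, neg_smul, sub_neg_eq_add, add_mul,
    one_mul, mul_sub, mul_one, smul_mul_assoc, mul_smul_comm, hXX, smul_sub]
  abel

/-! ### The operators `U_γ⁺` -/

lemma psiDenom_eq {ρ : Measure ℝ} (γ : ℂ) (x : ℝ) :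
    psiDenom ρ γ x = 1 + (2 * Real.pi * I * γ) * rieszProj (densityL2 ρ) x := by
  rw [psiDenom]

section Uplus

variable {ρ : Measure ℝ} {C : ℝ} {g : ℝ → ℂ}

/-- For Lebesgue-almost every `x`, `g` can differ from `1` only where the density vanishes, so the
factor `ḡ` changes nothing and the last operator in `U_γ⁺` is `J*`. -/
lemma IsMulOp.adjoint_density_congr [IsFiniteMeasure ρ] (hC : 0 ≤ C)
    (h : ρ ≤ ENNReal.ofReal C • volume)
    (hg : ∀ᵐ x ∂ρ, g x = 1) :
    IsMulOp ρ volume (fun x => conj (g x) * density ρ x) (opJ ρ).adjoint := by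
  have hac : ρ ≪ volume := Measure.absolutelyContinuous_of_le_smul h
  refine (isMulOp_adjoint_opJ hC h).congr ?_
  filter_upwards [ae_density_eq_zero_or hac hg] with x hx
  rcases hx with hx | hx
  · rw [hx, mul_zero]
  · rw [hx, map_one, one_mul]

/-- The factor `2π` in `2πiγ` cancels the one in the bound `C/2π`, so the perturbation of `1` is at
most `‖γ‖ C`. -/
lemma half_le_norm_psiDenom
    (hp : ∀ᵐ x, ‖rieszProj (densityL2 ρ) x‖ ≤ (2 * Real.pi)⁻¹ * C) {γ : ℂ}
    (hγ : ‖γ‖ * C ≤ 1 / 2) : ∀ᵐ x, 1 / 2 ≤ ‖psiDenom ρ γ x‖ := by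
  filter_upwards [hp] with x hx
  have h1 : ‖(2 * Real.pi * I * γ) * rieszProj (densityL2 ρ) x‖ ≤ 1 / 2 := by
    refine le_trans ?_ hγ
    rw [norm_mul]
    have e : ‖(2 * Real.pi * I * γ : ℂ)‖ = 2 * Real.pi * ‖γ‖ := by
      simp [abs_of_pos Real.pi_pos]
    rw [e]
    calc 2 * Real.pi * ‖γ‖ * ‖rieszProj (densityL2 ρ) x‖
        ≤ 2 * Real.pi * ‖γ‖ * ((2 * Real.pi)⁻¹ * C) := by gcongr
      _ = ‖γ‖ * C := by field_simp
  have h2 := norm_sub_le (psiDenom ρ γ x) ((2 * Real.pi * I * γ) * rieszProj (densityL2 ρ) x)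
  rw [psiDenom_eq, add_sub_cancel_right, norm_one, ← psiDenom_eq] at h2
  linarith

lemma aestronglyMeasurable_psi (γ : ℂ) : AEStronglyMeasurable (psi ρ γ) volume := by
  have : AEMeasurable (psiDenom ρ γ) volume := by
    simp only [funext (psiDenom_eq γ)]
    exact ((Lp.aestronglyMeasurable _).aemeasurable.const_mul _).const_add 1
  exact this.inv.aestronglyMeasurable

lemma memLp_top_psi (hp : ∀ᵐ x, ‖rieszProj (densityL2 ρ) x‖ ≤ (2 * Real.pi)⁻¹ * C) {γ : ℂ}
    (hγ : ‖γ‖ * C ≤ 1 / 2) : MemLp (psi ρ γ) ∞ volume := by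
  refine memLp_top_of_bound (aestronglyMeasurable_psi γ) 2 ?_
  filter_upwards [half_le_norm_psiDenom hp hγ] with x hx
  rw [psi, norm_inv]
  exact inv_le_of_inv_le₀ (by norm_num) (by linarith)

/-- Multiplication by `ψ_γ` is the inverse of multiplication by `1 + 2πiγ P₊ρ̃`. -/
lemma mulOp_psi_eq_inverse [IsFiniteMeasure ρ]
    (hp : ∀ᵐ x, ‖rieszProj (densityL2 ρ) x‖ ≤ (2 * Real.pi)⁻¹ * C) {G : L2 →L[ℂ] L2}
    (hG : IsMulOp volume volume (rieszProj (densityL2 ρ)) G) {γ : ℂ} (hγ : ‖γ‖ * C ≤ 1 / 2) :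
    (1 + (2 * Real.pi * I * γ) • G) * mulOp volume volume (psi ρ γ) = 1 ∧
      mulOp volume volume (psi ρ γ) * (1 + (2 * Real.pi * I * γ) • G) = 1 := by
  have hΨ := isMulOp_of_memLp_top (memLp_top_psi hp hγ)
  set Ψ := mulOp volume volume (psi ρ γ)
  have hne : ∀ᵐ x, psiDenom ρ γ x ≠ 0 := by
    filter_upwards [half_le_norm_psiDenom hp hγ] with x hx h0
    rw [h0, norm_zero] at hx
    linarith
  have hD : ∀ f : L2, (1 + (2 * Real.pi * I * γ) • G) f =ᵐ[volume]
      fun x => psiDenom ρ γ x * f x := by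
    intro f
    change (f + (2 * Real.pi * I * γ) • G f : L2) =ᵐ[volume] _
    filter_upwards [Lp.coeFn_add f ((2 * Real.pi * I * γ) • G f),
      Lp.coeFn_smul (2 * Real.pi * I * γ) (G f), hG.coeFn f] with x e1 e2 e3
    rw [e1, Pi.add_apply, e2, Pi.smul_apply, e3, smul_eq_mul, psiDenom_eq]
    ring
  constructor
  · ext1 f
    refine Lp.ext ?_
    filter_upwards [hD (Ψ f), hΨ.coeFn f, hne] with x e1 e2 e3
    change ((1 + (2 * Real.pi * I * γ) • G) (Ψ f)) x = f x
    rw [e1, e2, psi, mul_inv_cancel_left₀ e3]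
  · ext1 f
    refine Lp.ext ?_
    filter_upwards [hD f, hΨ.coeFn ((1 + (2 * Real.pi * I * γ) • G) f), hne] with x e1 e2 e3
    change (Ψ ((1 + (2 * Real.pi * I * γ) • G) f)) x = f x
    rw [e2, e1, psi, inv_mul_cancel_left₀ e3]

lemma memLp_top_psi_mul [IsFiniteMeasure ρ] (hg_bdd : MemLp g ∞ volume)
    (hp : ∀ᵐ x, ‖rieszProj (densityL2 ρ) x‖ ≤ (2 * Real.pi)⁻¹ * C) {γ : ℂ}
    (hγ : ‖γ‖ * C ≤ 1 / 2) : MemLp (fun x => psi ρ γ x * g x) ∞ volume :=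
  hg_bdd.mul (memLp_top_psi hp hγ)

/-- The function `g` may be dropped from the formula for `U_γ⁺`. -/
lemma Uplus_eq [IsFiniteMeasure ρ] (hC : 0 ≤ C) (h : ρ ≤ ENNReal.ofReal C • volume)
    (hg_bdd : MemLp g ∞ volume) (hg : ∀ᵐ x ∂ρ, g x = 1)
    (hp : ∀ᵐ x, ‖rieszProj (densityL2 ρ) x‖ ≤ (2 * Real.pi)⁻¹ * C) {γ : ℂ}
    (hγ : ‖γ‖ * C ≤ 1 / 2) :
    Uplus ρ g γ = 1 - (2 * Real.pi * I * γ) •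
      (opJ ρ ∘L mulOp volume volume (psi ρ γ) ∘L rieszProj ∘L (opJ ρ).adjoint) := by
  have hac : ρ ≪ volume := Measure.absolutelyContinuous_of_le_smul h
  have hJ := isMulOp_opJ_of_le ENNReal.ofReal_ne_top h
  have e : opJ ρ ∘L mulOp volume volume (fun x => psi ρ γ x * g x) =
      opJ ρ ∘L mulOp volume volume (psi ρ γ) := by
    ext1 f
    refine Lp.ext ?_
    have h1 := (isMulOp_of_memLp_top (memLp_top_psi_mul hg_bdd hp hγ)).coeFn f
    have h2 := (isMulOp_of_memLp_top (memLp_top_psi hp hγ)).coeFn f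
    filter_upwards [hJ.coeFn (mulOp volume volume (fun x => psi ρ γ x * g x) f),
      hJ.coeFn (mulOp volume volume (psi ρ γ) f), hac.ae_le h1, hac.ae_le h2, hg]
      with x e1 e2 e3 e4 e5
    rw [ContinuousLinearMap.comp_apply, ContinuousLinearMap.comp_apply, e1, e2, e3, e4, e5,
      mul_one]
  rw [Uplus, (IsMulOp.adjoint_density_congr hC h hg).mulOp_eq, ← ContinuousLinearMap.comp_assoc, e]
  rfl

lemma uplusWellDefined [IsFiniteMeasure ρ] (hC : 0 ≤ C) (h : ρ ≤ ENNReal.ofReal C • volume)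
    (hg_bdd : MemLp g ∞ volume) (hg : ∀ᵐ x ∂ρ, g x = 1)
    (hp : ∀ᵐ x, ‖rieszProj (densityL2 ρ) x‖ ≤ (2 * Real.pi)⁻¹ * C) {γ : ℂ}
    (hγ : ‖γ‖ * C ≤ 1 / 2) : UplusWellDefined ρ g γ where
  absolutelyContinuous := Measure.absolutelyContinuous_of_le_smul h
  density_bounded := memLp_top_density ρ hC h
  density_memL2 := memLp_two_density ρ hC h
  psiDenom_ne_zero := by
    filter_upwards [half_le_norm_psiDenom hp hγ] with x hx h0
    rw [h0, norm_zero] at hx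
    linarith
  psi_bounded := memLp_top_psi hp hγ
  isMulOp_opJ := isMulOp_opJ_of_le ENNReal.ofReal_ne_top h
  isMulOp_psi := isMulOp_of_memLp_top (memLp_top_psi_mul hg_bdd hp hγ)
  isMulOp_density := by
    have := IsMulOp.adjoint_density_congr hC h hg
    rw [this.mulOp_eq]
    exact this

lemma Uplus_coeFn [IsFiniteMeasure ρ] (hC : 0 ≤ C) (h : ρ ≤ ENNReal.ofReal C • volume)
    (hg_bdd : MemLp g ∞ volume) (hg : ∀ᵐ x ∂ρ, g x = 1)
    (hp : ∀ᵐ x, ‖rieszProj (densityL2 ρ) x‖ ≤ (2 * Real.pi)⁻¹ * C) {γ : ℂ}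
    (hγ : ‖γ‖ * C ≤ 1 / 2) (f : Lp ℂ 2 ρ) :
    Uplus ρ g γ f =ᵐ[ρ] fun x => f x - (2 * Real.pi * I * γ) *
      (psi ρ γ x * rieszProj ((opJ ρ).adjoint f) x) := by
  have hac : ρ ≪ volume := Measure.absolutelyContinuous_of_le_smul h
  have hJ := isMulOp_opJ_of_le ENNReal.ofReal_ne_top h
  have hΨ := isMulOp_of_memLp_top (memLp_top_psi hp hγ)
  rw [Uplus_eq hC h hg_bdd hg hp hγ]
  set q : L2 := rieszProj ((opJ ρ).adjoint f) with hq
  set w := mulOp volume volume (psi ρ γ) q with hw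
  change (f - (2 * Real.pi * I * γ) • opJ ρ w : Lp ℂ 2 ρ) =ᵐ[ρ] _
  filter_upwards [Lp.coeFn_sub f ((2 * Real.pi * I * γ) • opJ ρ w),
    Lp.coeFn_smul (2 * Real.pi * I * γ) (opJ ρ w), hJ.coeFn w, hac.ae_le (hΨ.coeFn q)]
    with x e1 e2 e3 e4
  rw [e1, Pi.sub_apply, e2, Pi.smul_apply, e3, e4, smul_eq_mul, one_mul]

/-- The intertwining relation between `A + γ B` and `A`. -/
lemma Uplus_mul_eq [IsFiniteMeasure ρ] (hρ : IsCompact ρ.support)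
    (hC : 0 ≤ C) (h : ρ ≤ ENNReal.ofReal C • volume)
    (hg_bdd : MemLp g ∞ volume) (hg : ∀ᵐ x ∂ρ, g x = 1)
    (hp : ∀ᵐ x, ‖rieszProj (densityL2 ρ) x‖ ≤ (2 * Real.pi)⁻¹ * C) {γ : ℂ}
    (hγ : ‖γ‖ * C ≤ 1 / 2) :
    Uplus ρ g γ * (opA ρ + γ • opB ρ g hg) = opA ρ * Uplus ρ g γ := by
  have hac : ρ ≪ volume := Measure.absolutelyContinuous_of_le_smul h
  have hA := isMulOp_opA hρ
  have hd := memLp_two_density ρ hC h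
  have hU := Uplus_coeFn hC h hg_bdd hg hp hγ
  set b : ℂ := 2 * Real.pi * I * γ with hb
  ext1 f
  set k := opA ρ f with hk
  set g1 := (memLp_of_ae_eq_one hg).toLp g with hg1
  set β : ℂ := inner ℂ g1 f with hβ
  -- This identifies the coefficient produced by `B` with the integral produced by the commutator.
  have hβ' : β = ∫ x, density ρ x * f x := by
    rw [integral_density_mul ρ hac, hβ, inner_eq_integral_conj_mul]
    refine integral_congr_ae ?_
    filter_upwards [(memLp_of_ae_eq_one hg).coeFn_toLp, hg] with x e1 e2
    rw [e1, e2, map_one, one_mul]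
  have hL : (Uplus ρ g γ * (opA ρ + γ • opB ρ g hg)) f =
      Uplus ρ g γ k + (γ * β) • Uplus ρ g γ g1 := by
    have : (opA ρ + γ • opB ρ g hg) f = k + γ • (β • g1) := rfl
    rw [mul_apply_eq_comp, this, map_add, smul_smul, map_smul]
  rw [hL]
  change _ = opA ρ (Uplus ρ g γ f)
  have hf2 := memLp_two_density_mul hC h (Lp.memLp f)
  have hf1 := integrable_density_mul hac (Lp.memLp f)
  have hk2 := memLp_two_density_mul hC h (Lp.memLp k)
  have hk1 := integrable_density_mul hac (Lp.memLp k)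
  have eSf : (opJ ρ).adjoint f = hf2.toLp _ := by
    have := adjoint_opJ_toLp hC h (Lp.memLp f) hf2 EventuallyEq.rfl
    rwa [Lp.toLp_coeFn] at this
  have eSk : (opJ ρ).adjoint k = hk2.toLp _ := by
    have := adjoint_opJ_toLp hC h (Lp.memLp k) hk2 EventuallyEq.rfl
    rwa [Lp.toLp_coeFn] at this
  have eSg : (opJ ρ).adjoint g1 = densityL2 ρ := by
    rw [densityL2_eq hd]
    refine adjoint_opJ_toLp hC h _ hd ?_
    filter_upwards [ae_density_eq_zero_or hac hg] with x hx
    rcases hx with hx | hx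
    · rw [hx, zero_mul]
    · rw [hx, mul_one]
  have hkx : ∀ᵐ x : ℝ, density ρ x * k x = x * (density ρ x * f x) := by
    filter_upwards [ae_density_eq_zero_or hac (hA.coeFn f)] with x hx
    rcases hx with hx | hx
    · rw [hx, zero_mul, zero_mul, mul_zero]
    · rw [hk, hx]; ring
  have hcomm := ofReal_mul_rieszProj hf1 hf2 hk1 hk2 hkx
  rw [← eSf, ← eSk, ← hβ'] at hcomm
  have hne : ∀ᵐ x, psiDenom ρ γ x ≠ 0 := by
    filter_upwards [half_le_norm_psiDenom hp hγ] with x hx h0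
    rw [h0, norm_zero] at hx
    linarith
  have hUg := hU g1
  rw [eSg] at hUg
  refine Lp.ext ?_
  filter_upwards [Lp.coeFn_add (Uplus ρ g γ k) ((γ * β) • Uplus ρ g γ g1),
    Lp.coeFn_smul (γ * β) (Uplus ρ g γ g1), hU k, hUg, hU f, hA.coeFn (Uplus ρ g γ f),
    hA.coeFn f, hac.ae_le hcomm, hac.ae_le hne, (memLp_of_ae_eq_one hg).coeFn_toLp, hg]
    with x e1 e2 e3 e4 e5 e6 e7 e8 e9 e10 e11
  rw [e1, Pi.add_apply, e2, Pi.smul_apply, e3, e4, e6, e5, hk, e7, hg1, e10, e11, smul_eq_mul]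
  -- Hence `U g = 1 - bψ P₊ρ̃ = ψ`. The term `γβ ψ` coming from `γB` then cancels `bψ` times the
  -- commutator, which is `-γβ ψ`.
  have hψ : psi ρ γ x * (1 + b * rieszProj (densityL2 ρ) x) = 1 := by
    rw [hb, ← psiDenom_eq, psi, inv_mul_cancel₀ e9]
  have hpi : (2 * Real.pi * I : ℂ) ≠ 0 := by simp [Real.pi_ne_zero]
  have hbb : b * ((2 * Real.pi * I)⁻¹ * β) = γ * β := by
    rw [hb]; field_simp
  linear_combination -(γ * β) * hψ + (b * psi ρ γ x) * e8 - psi ρ γ x * hbb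

end Uplus

lemma conj_two_pi_I_mul (γ : ℝ) :
    conj (2 * Real.pi * I * (γ : ℂ)) = -(2 * Real.pi * I * (γ : ℂ)) := by
  simp [map_ofNat]

end Friedrichs

/-! ### Choice of the radius, holomorphy and unitarity. -/

open Friedrichs Filter Topology in
theorem theorem4p9 (ρ : MeasureTheory.Measure ℝ) [MeasureTheory.IsFiniteMeasure ρ]
    (hρ : IsCompact ρ.support) (hBTB : Friedrichs.BTB ρ)
    (g : ℝ → ℂ) (hg_bdd : MeasureTheory.MemLp g ⊤ MeasureTheory.volume)
    (hg : ∀ᵐ x ∂ρ, g x = 1) :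
    (∃ δ : ℝ, 0 < δ ∧
      (∀ γ ∈ Metric.ball (0 : ℂ) δ, Friedrichs.UplusWellDefined ρ g γ) ∧
      DifferentiableOn ℂ (Friedrichs.Uplus ρ g) (Metric.ball 0 δ) ∧
      ∀ γ : ℝ, |γ| < δ →
        ∃ V : unitary (MeasureTheory.Lp ℂ 2 ρ →L[ℂ] MeasureTheory.Lp ℂ 2 ρ),
          (V : MeasureTheory.Lp ℂ 2 ρ →L[ℂ] MeasureTheory.Lp ℂ 2 ρ) = Friedrichs.Uplus ρ g γ ∧
          Friedrichs.opA ρ + (γ : ℂ) • Friedrichs.opB ρ g hg =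
            ((V⁻¹ : unitary (MeasureTheory.Lp ℂ 2 ρ →L[ℂ] MeasureTheory.Lp ℂ 2 ρ)) :
              MeasureTheory.Lp ℂ 2 ρ →L[ℂ] MeasureTheory.Lp ℂ 2 ρ) *
              Friedrichs.opA ρ * Friedrichs.Uplus ρ g γ) ∧
    Friedrichs.HUE (Friedrichs.opA ρ) (Friedrichs.opB ρ g hg) := by
  have main : ∃ δ : ℝ, 0 < δ ∧
      (∀ γ ∈ Metric.ball (0 : ℂ) δ, UplusWellDefined ρ g γ) ∧
      DifferentiableOn ℂ (Uplus ρ g) (Metric.ball 0 δ) ∧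
      ∀ γ : ℝ, |γ| < δ → ∃ V : unitary (Lp ℂ 2 ρ →L[ℂ] Lp ℂ 2 ρ),
        (V : Lp ℂ 2 ρ →L[ℂ] Lp ℂ 2 ρ) = Uplus ρ g γ ∧
        opA ρ + (γ : ℂ) • opB ρ g hg =
          ((V⁻¹ : unitary (Lp ℂ 2 ρ →L[ℂ] Lp ℂ 2 ρ)) : Lp ℂ 2 ρ →L[ℂ] Lp ℂ 2 ρ) *
            opA ρ * Uplus ρ g γ := by
    obtain ⟨C, hBT⟩ := hBTB
    have hC : 0 ≤ C := (norm_nonneg _).trans (hBT I (by simp))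
    have hle := measure_le_volume ρ hBT
    have hac : ρ ≪ volume := Measure.absolutelyContinuous_of_le_smul hle
    have hd := memLp_two_density ρ hC hle
    have hcauchy := norm_cauchy_density_le hac hBT
    have hp : ∀ᵐ x, ‖rieszProj (densityL2 ρ) x‖ ≤ (2 * Real.pi)⁻¹ * C := by
      rw [densityL2_eq hd]
      exact norm_rieszProj_le (integrable_density ρ) hd hcauchy
    set G := mulOp volume volume (rieszProj (densityL2 ρ)) with hGdef
    have hG : IsMulOp volume volume (rieszProj (densityL2 ρ)) G :=
      isMulOp_of_memLp_top (memLp_top_of_bound (Lp.aestronglyMeasurable _) _ hp)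
    have hGW : ∀ k ∈ hardySpace, G k ∈ hardySpace := by
      rw [densityL2_eq hd] at hG
      exact fun k hk => hG.mem_hardySpace (integrable_density ρ) hd hcauchy hk
    -- The first bound keeps `1 + 2πiγ P₊ρ̃` at least `1/2` in modulus; the second makes `‖2πiγ G‖ <
    -- 1` for the Neumann series. Adding `1` avoids dividing by zero.
    set δ₀ : ℝ := min (1 / (2 * (C + 1))) (1 / (2 * Real.pi * (‖G‖ + 1))) with hδ₀
    have hδ₀pos : 0 < δ₀ := by positivity
    have hγC : ∀ γ ∈ Metric.ball (0 : ℂ) δ₀, ‖γ‖ * C ≤ 1 / 2 := by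
      intro γ hγ
      have h1 : ‖γ‖ < 1 / (2 * (C + 1)) :=
        (mem_ball_zero_iff.1 hγ).trans_le (min_le_left _ _)
      rw [lt_div_iff₀ (by positivity)] at h1
      nlinarith [norm_nonneg γ]
    have hγG : ∀ γ ∈ Metric.ball (0 : ℂ) δ₀, ‖-((2 * Real.pi * I * γ) • G)‖ < 1 := by
      intro γ hγ
      have h1 : ‖γ‖ < 1 / (2 * Real.pi * (‖G‖ + 1)) :=
        (mem_ball_zero_iff.1 hγ).trans_le (min_le_right _ _)
      rw [lt_div_iff₀ (by positivity)] at h1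
      have e : ‖(2 * Real.pi * I * γ : ℂ)‖ = 2 * Real.pi * ‖γ‖ := by
        simp [abs_of_pos Real.pi_pos]
      rw [norm_neg, norm_smul, e]
      nlinarith [mul_nonneg Real.pi_pos.le (norm_nonneg γ)]
    have hinv : ∀ γ ∈ Metric.ball (0 : ℂ) δ₀, mulOp volume volume (psi ρ γ) =
        Ring.inverse (1 + (2 * Real.pi * I * γ) • G) := by
      intro γ hγ
      obtain ⟨h1, h2⟩ := mulOp_psi_eq_inverse hp hG (hγC γ hγ)
      exact (Ring.inverse_unit ⟨_, _, h1, h2⟩).symm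
    have hunit : ∀ γ ∈ Metric.ball (0 : ℂ) δ₀, IsUnit (1 + (2 * Real.pi * I * γ) • G) := by
      intro γ hγ
      obtain ⟨h1, h2⟩ := mulOp_psi_eq_inverse hp hG (hγC γ hγ)
      exact ⟨⟨_, _, h1, h2⟩, rfl⟩
    have hdiff : DifferentiableOn ℂ (Uplus ρ g) (Metric.ball 0 δ₀) := by
      have hlin : Differentiable ℂ fun γ : ℂ => (2 * Real.pi * I * γ : ℂ) :=
        differentiable_id.const_mul _
      have hD : DifferentiableOn ℂ (fun γ : ℂ => Ring.inverse (1 + (2 * Real.pi * I * γ) • G))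
          (Metric.ball 0 δ₀) := by
        intro γ hγ
        obtain ⟨w, hw⟩ := hunit γ hγ
        have hi : DifferentiableAt ℂ Ring.inverse (1 + (2 * Real.pi * I * γ) • G) := by
          rw [← hw]
          exact differentiableAt_inverse w.isUnit
        exact (hi.comp γ (((hlin γ).smul_const G).const_add 1)).differentiableWithinAt
      have hX : DifferentiableOn ℂ (fun γ : ℂ => opJ ρ ∘L
          (Ring.inverse (1 + (2 * Real.pi * I * γ) • G) ∘L (rieszProj ∘L (opJ ρ).adjoint)))
          (Metric.ball 0 δ₀) :=
        (differentiableOn_const _).clm_comp (hD.clm_comp (differentiableOn_const _))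
      refine ((differentiableOn_const 1).sub (hlin.differentiableOn.smul hX)).congr fun γ hγ => ?_
      rw [Uplus_eq hC hle hg_bdd hg hp (hγC γ hγ), hinv γ hγ]
      rfl
    have hball : Metric.ball (0 : ℂ) δ₀ ∈ 𝓝 (0 : ℂ) := Metric.ball_mem_nhds _ hδ₀pos
    have hU0 : Uplus ρ g 0 = 1 := by
      rw [Uplus, mul_zero, zero_smul, sub_zero]
      rfl
    -- Invertibility near `γ = 0` is what upgrades the isometry to a unitary: a left inverse of a
    -- unit is two-sided. It costs a second shrinking of the radius.
    have hUunit : ∀ᶠ γ in 𝓝 (0 : ℂ), IsUnit (Uplus ρ g γ) := by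
      have hc : ContinuousAt (Uplus ρ g) 0 := (hdiff.differentiableAt hball).continuousAt
      refine hc.eventually ?_
      rw [hU0]
      exact Units.nhds 1
    obtain ⟨δ₁, hδ₁, hδ₁U⟩ := Metric.eventually_nhds_iff_ball.1 hUunit
    have hsub : Metric.ball (0 : ℂ) (min δ₀ δ₁) ⊆ Metric.ball 0 δ₀ :=
      Metric.ball_subset_ball (min_le_left _ _)
    refine ⟨min δ₀ δ₁, lt_min hδ₀pos hδ₁, fun γ hγ =>
      uplusWellDefined hC hle hg_bdd hg hp (hγC γ (hsub hγ)), hdiff.mono hsub, fun γ hγ => ?_⟩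
    have hγb : (γ : ℂ) ∈ Metric.ball (0 : ℂ) (min δ₀ δ₁) := by
      rwa [mem_ball_zero_iff, Complex.norm_real]
    have hγ0 := hsub hγb
    have hiso : star (Uplus ρ g γ) * Uplus ρ g γ = 1 := by
      rw [Uplus_eq hC hle hg_bdd hg hp (hγC _ hγ0)]
      refine isometry_of_add_star (conj_two_pi_I_mul γ)
        (add_adjoint_mulOp_rieszProj hC hle hG) ?_
        (mulOp_psi_eq_inverse hp hG (hγC _ hγ0)).1 ?_
      · exact (isSelfAdjoint_starProjection hardySpace).star_eq
      -- `PΨP = ΨP` says that `Ψ` maps the Hardy space into itself.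
      · ext1 k
        refine Submodule.starProjection_eq_self_iff.2 ?_
        rw [hinv _ hγ0, ← sub_neg_eq_add]
        refine inverse_one_sub_mem (hγG _ hγ0) isClosed_hardySpace (fun k hk => ?_)
          (Submodule.starProjection_apply_mem _ _)
        exact hardySpace.neg_mem (hardySpace.smul_mem _ (hGW k hk))
    have hiso' : Uplus ρ g γ * star (Uplus ρ g γ) = 1 := by
      obtain ⟨w, hw⟩ := hδ₁U _ (Metric.ball_subset_ball (min_le_right _ _) hγb)
      have h1 : star (Uplus ρ g γ) = ↑w⁻¹ := by
        rw [← hw] at hiso ⊢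
        exact left_inv_eq_right_inv hiso w.mul_inv
      rw [h1, ← hw, Units.mul_inv]
    refine ⟨⟨Uplus ρ g γ, Unitary.mem_iff.2 ⟨hiso, hiso'⟩⟩, rfl, ?_⟩
    change _ = star (Uplus ρ g γ) * opA ρ * Uplus ρ g γ
    rw [mul_assoc, ← Uplus_mul_eq hρ hC hle hg_bdd hg hp (hγC _ hγ0), ← mul_assoc, hiso, one_mul]
  refine ⟨main, ?_⟩
  obtain ⟨δ, hδ, -, hdiff, hV⟩ := main
  choose V hVU hVA using hV
  -- The value `1` for `|γ| ≥ δ` is arbitrary, since nothing is required there.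
  refine ⟨δ, hδ, fun γ => if h : |γ| < δ then V γ h else 1, fun γ hγ => ?_,
    Uplus ρ g, hdiff, fun γ hγ => ?_⟩
  · simp only [dif_pos hγ]
    rw [hVU γ hγ]
    exact hVA γ hγ
  · simp only [dif_pos hγ]
    exact (hVU γ hγ).symm
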